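/- Let $R=\mathbb{Z}[x]$ and $F=\operatorname{Frac}(R)$. For $n\ge 0$ let $\mathcal{A}_n$ be the Temperley--Lieb algebra over $R$, i.e. the unital associative algebra generated by $e_1,\dots,e_{n-1}$ with relations $e_i^2=xe_i$, $e_ie_{i\pm1}e_i=e_i$, and $e_ie_j=e_je_i$ for $|i-j|\ge2$; let $\mathcal{A}_{n,F}=\mathcal{A}_n\otimes_RF$. A partition of $n$ is a pair $\lambda=(f,n-2f)$ with $0\le 2f\le n$. Write $\mathfrak{T}_n(\lambda)$ for the set of sequences $\mathfrak{t}=(\lambda^{(0)},\dots,\lambda^{(n)})$, where $\lambda^{(k)}=(i_k,k-2i_k)$ is a partition of $k$, $i_0=0$, $i_k-i_{k-1}\in\{0,1\}$ and $\lambda^{(n)}=\lambda$; let $\dim(\lambda)=\#\mathfrak{T}_n(\lambda)$. Put $m_\lambda=e_1e_3\cdots e_{2f-1}$, and let $v_{\mathfrak t}$ be the product, over those $k$ with $i_k=i_{k-1}+1$ and with larger $k$ to the left, of the elements $e_{2i_k}e_{2i_k+1}\cdots e_{k-1}$ (equal to $1$ if $k=2i_k$); $v_{\mathfrak t}^*$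 is the product of the same generators in reverse order, and $m_{\mathfrak{st}}=v_{\mathfrak s}^*m_\lambda v_{\mathfrak t}$. Let $\check{\mathcal{A}}_n^\lambda$ be the two-sided ideal generated by the $m_{(k,n-2k)}$ with $f<k\le n/2$. The cell module $C^\lambda$ is the right submodule of $\mathcal{A}_n/\check{\mathcal{A}}_n^\lambda$ generated by the class of $m_\lambda$; write $m_{\mathfrak t}\in C^\lambda$ for the class of $m_\lambda v_{\mathfrak t}$. The bilinear form on $C^\lambda$ is determined by $m_{\mathfrak{us}}m_{\mathfrak{tw}}\equiv\langle m_{\mathfrak s},m_{\mathfrak t}\rangle m_{\mathfrak{uw}}\bmod\check{\mathcal{A}}_n^\lambda$ for all $\mathfrak{s},\mathfrak{t},\mathfrak{u},\mathfrak{w}\in\mathfrak{T}_n(\lambda)$. The same notation is used over $F$. Define $p_0=0$, $p_1=1$, $p_{i+1}=xp_i-p_{i-1}$. Define $T_0=T_1=0$, $T_2=e_1$ and, for $2\le i<n$, $T_{i+1}=-e_iT_i-T_ie_i+e_ie_{i-1}T_ie_i-z_{i-1}-e_iz_{i-2}$, where $z_j=\sum_{k=0}^jx^kT_{j-k}$.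 For $\mathfrak{t}$ as above and $2\le k\le n$ let $r_{\mathfrak t}(k)=(p_{i_k}-xp_{i_k-1})p_{k-i_k+1}$ if $i_k=i_{k-1}+1$, and $r_{\mathfrak t}(k)=(p_{k-i_k+1}-xp_{k-i_k})p_{i_k}$ if $i_k=i_{k-1}$. Let $\mathfrak{R}(k)$ be the set of all $r_{\mathfrak s}(k)$ with $\mathfrak{s}\in\mathfrak{T}_k(\mu)$, $\mu$ a partition of $k$, and over $F$ put $$f_{\mathfrak t}=m_{\mathfrak t}\prod_{k=2}^n\ \prod_{r\in\mathfrak{R}(k),\,r\ne r_{\mathfrak t}(k)}\frac{T_k-r}{r_{\mathfrak t}(k)-r}\in C^\lambda,\qquad \det(\lambda)=\prod_{\mathfrak{t}\in\mathfrak{T}_n(\lambda)}\langle f_{\mathfrak t},f_{\mathfrak t}\rangle\in F .$$ Lemma. Let $\lambda=(f,n-2f)$ be a partition of $n$. Then $\det(\lambda)$ is the determinant of the Gram matrix $\bigl(\langle m_{\mathfrak s},m_{\mathfrak t}\rangle\bigr)_{\mathfrak{s},\mathfrak{t}\in\mathfrak{T}_n(\lambda)}$ of $C^\lambda$ (over $R$).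 If $n-2f>0$, then $$\det(\lambda)=\prod_{j=0}^{f-1}\left(\frac{p_{n-f-j+1}}{p_{f-j}}\right)^{\dim(\mu_j)},\qquad \mu_j=(j,n-2j),$$ and if $n=2f$ with $f\ge1$, then $\det(\lambda)=\det(\mu)\cdot x^{\dim(\lambda)}$, where $\mu=(f-1,1)$, a partition of $n-1$. -/

import Mathlib

open Polynomial

namespace TemperleyLieb

/-! ### Tableaux

A partition `(i, n - 2i)` of `n` is recorded by its first entry `i`, where `2i ≤ n`. -/

/-- The set `𝔗_n(λ)` for `λ = (f, n - 2f)`: the sequences of partitions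
`λ⁽ᵏ⁾ = (t k, k - 2 (t k))` of `k = 0, …, n` with `λ⁽⁰⁾ = (0, 0)`, `λ⁽ᵏ⁾ → λ⁽ᵏ⁺¹⁾` and
`λ⁽ⁿ⁾ = λ`. -/
def Tableau (n f : ℕ) : Type :=
  {t : Fin (n + 1) → ℕ //
    t 0 = 0 ∧ (∀ k : Fin (n + 1), 2 * t k ≤ (k : ℕ)) ∧
      (∀ k : Fin n, t k.succ = t k.castSucc ∨ t k.succ = t k.castSucc + 1) ∧
      t (Fin.last n) = f}

namespace Tableau

/-- The first entry of the partition `λ⁽ᵏ⁾`, for `k ≤ n` (and `0` for `k > n`). -/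
def entry {n f : ℕ} (t : Tableau n f) (k : ℕ) : ℕ :=
  if h : k < n + 1 then t.1 ⟨k, h⟩ else 0

noncomputable instance (n f : ℕ) : Fintype (Tableau n f) :=
  Fintype.ofInjective
    (fun (t : Tableau n f) (k : Fin (n + 1)) =>
      (⟨t.1 k, by have := t.2.2.1 k; omega⟩ : Fin (n + 1)))
    (by
      intro s t h
      apply Subtype.ext
      funext k
      exact congrArg Fin.val (congrFun h k))

end Tableau

/-- `dim(λ) = #𝔗_n(λ)` for `λ = (f, n - 2f)`. -/
noncomputable def dim (n f : ℕ) : ℕ := Fintype.card (Tableau n f)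

/-! ### The algebra -/

section Algebra

variable {S : Type*} [CommRing S] (δ : S) (n : ℕ)

/-- The defining relations; the index `i : Fin (n - 1)` stands for the generator `e_{i+1}`. -/
inductive Rel : FreeAlgebra S (Fin (n - 1)) → FreeAlgebra S (Fin (n - 1)) → Prop
  | sq (i : Fin (n - 1)) :
      Rel (FreeAlgebra.ι S i * FreeAlgebra.ι S i) (δ • FreeAlgebra.ι S i)
  | braid (i j : Fin (n - 1)) (h : (i : ℕ) + 1 = j ∨ (j : ℕ) + 1 = i) :
      Rel (FreeAlgebra.ι S i * FreeAlgebra.ι S j * FreeAlgebra.ι S i) (FreeAlgebra.ι S i)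
  | comm (i j : Fin (n - 1)) (h : (i : ℕ) + 2 ≤ j ∨ (j : ℕ) + 2 ≤ i) :
      Rel (FreeAlgebra.ι S i * FreeAlgebra.ι S j) (FreeAlgebra.ι S j * FreeAlgebra.ι S i)

/-- The Temperley--Lieb algebra on `e_1, …, e_{n-1}` over `S` with parameter `δ`. -/
abbrev Alg : Type _ := RingQuot (Rel δ n)

/-- The generator `e_i`, for `1 ≤ i ≤ n - 1` (and `0` for the other `i`, which never occur). -/
noncomputable def e (i : ℕ) : Alg δ n :=
  if h : 1 ≤ i ∧ i < n then
    RingQuot.mkAlgHom S (Rel δ n) (FreeAlgebra.ι S ⟨i - 1, by omega⟩)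
  else 0

/-- `w_{i,j} = e_i e_{i+1} ⋯ e_{j-1}` if `i < j`, `e_{i-1} e_{i-2} ⋯ e_j` if `j < i`, and `1`
if `i = j`. -/
noncomputable def w (i j : ℕ) : Alg δ n :=
  if i ≤ j then ((List.range' i (j - i)).map (e δ n)).prod
  else ((List.range' j (i - j)).reverse.map (e δ n)).prod

/-- `m_λ = e_1 e_3 ⋯ e_{2f-1}` for `λ = (f, n - 2f)`. -/
noncomputable def m (f : ℕ) : Alg δ n :=
  ((List.range f).map fun i => e δ n (2 * i + 1)).prod

/-- The element `v_{𝔱|_k}`, where `a k` is the first entry of the `k`-th partition of `𝔱`. -/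
noncomputable def vAux (a : ℕ → ℕ) : ℕ → Alg δ n
  | 0 => 1
  | k + 1 => if a (k + 1) = a k then vAux a k else w δ n (2 * a (k + 1)) (k + 1) * vAux a k

/-- The element `v_{𝔱|_k}^*`. -/
noncomputable def vStarAux (a : ℕ → ℕ) : ℕ → Alg δ n
  | 0 => 1
  | k + 1 =>
    if a (k + 1) = a k then vStarAux a k else vStarAux a k * w δ n (k + 1) (2 * a (k + 1))

variable {n}

/-- `v_𝔱`. -/
noncomputable def v {f : ℕ} (t : Tableau n f) : Alg δ n := vAux δ n t.entry n

/-- `v_𝔱^*`. -/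
noncomputable def vStar {f : ℕ} (t : Tableau n f) : Alg δ n := vStarAux δ n t.entry n

/-- `m_{𝔰𝔱} = v_𝔰^* m_λ v_𝔱`. -/
noncomputable def murphy {f : ℕ} (s t : Tableau n f) : Alg δ n :=
  vStar δ s * m δ n f * v δ t

variable (n)

/-! ### Cell modules and their forms -/

/-- The two-sided ideal `𝒜_n^λ` generated by `m_λ`, for `λ = (f, n - 2f)`. -/
noncomputable def cellIdeal (f : ℕ) : TwoSidedIdeal (Alg δ n) := TwoSidedIdeal.span {m δ n f}

/-- The sum of the ideals `𝒜_n^μ` over the partitions `μ = (k, n - 2k)` of `n` with `k > f`. -/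
noncomputable def checkIdeal (f : ℕ) : TwoSidedIdeal (Alg δ n) :=
  ⨆ (k : ℕ) (_ : f < k ∧ 2 * k ≤ n), cellIdeal δ n k

/-- The quotient of the algebra by the ideal `checkIdeal`. -/
abbrev Quo (f : ℕ) : Type _ := (checkIdeal δ n f).ringCon.Quotient

/-- The quotient map. -/
noncomputable def toQuo (f : ℕ) : Alg δ n →+* Quo δ n f := (checkIdeal δ n f).ringCon.mk'

/-- The cell module `C^λ`: the right submodule of the quotient generated by the class of `m_λ`,
that is the set of the products of that class with elements of the quotient on the right. -/
noncomputable def cellModule (f : ℕ) : Submodule S (Quo δ n f) :=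
  LinearMap.range (LinearMap.mulLeft S (toQuo δ n f (m δ n f)))

variable {δ n}

/-- The right action of the algebra on the cell module. -/
noncomputable def act {f : ℕ} (c : cellModule δ n f) (a : Alg δ n) : cellModule δ n f :=
  ⟨(c : Quo δ n f) * toQuo δ n f a, by
    obtain ⟨_, b, rfl⟩ := c
    exact ⟨b * toQuo δ n f a, by simp [mul_assoc]⟩⟩

variable (δ n)

/-- The generator `m_{𝔱^λ}` of `C^λ`, the class of `m_λ`. -/
noncomputable def cellGen (f : ℕ) : cellModule δ n f :=
  ⟨toQuo δ n f (m δ n f), 1, by simp⟩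

variable {n}

/-- The element `m_𝔱 = m_{𝔱^λ} v_𝔱` of `C^λ`. -/
noncomputable def mBasis {f : ℕ} (t : Tableau n f) : cellModule δ n f :=
  act (cellGen δ n f) (v δ t)

variable (n)

/-- The property that characterizes the bilinear form of the cell module `C^λ`:
`m_{𝔲𝔰} m_{𝔱𝔴} ≡ ⟨m_𝔰, m_𝔱⟩ m_{𝔲𝔴}` modulo `checkIdeal`. -/
def IsCellForm (f : ℕ) (B : LinearMap.BilinForm S (cellModule δ n f)) : Prop :=
  ∀ s t u w : Tableau n f,
    murphy δ u s * murphy δ t w - B (mBasis δ s) (mBasis δ t) • murphy δ u w ∈ checkIdeal δ n f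

open Classical in
/-- The bilinear form `⟨ , ⟩` of the cell module `C^λ`: the unique form with the property
`IsCellForm`. -/
noncomputable def cellForm (f : ℕ) : LinearMap.BilinForm S (cellModule δ n f) :=
  if h : ∃! B, IsCellForm δ n f B then h.choose else 0

open Classical in
/-- The determinant of the Gram matrix `(⟨m_𝔰, m_𝔱⟩)` of the cell module. -/
noncomputable def gramDet (f : ℕ) : S :=
  Matrix.det (Matrix.of fun s t : Tableau n f => cellForm δ n f (mBasis δ s) (mBasis δ t))

/-! ### Jucys--Murphy elements and their eigenvalues -/

/-- The Jucys--Murphy elements: `T_0 = T_1 = 0`, `T_2 = e_1` and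
`T_{i+1} = -e_i T_i - T_i e_i + e_i e_{i-1} T_i e_i - z_{i-1} - e_i z_{i-2}` for `i ≥ 2`, where
`z_j = ∑_{k=0}^j δ^k T_{j-k}`. -/
noncomputable def jm : ℕ → Alg δ n
  | 0 => 0
  | 1 => 0
  | 2 => e δ n 1
  | i + 3 =>
    -(e δ n (i + 2) * jm (i + 2)) - jm (i + 2) * e δ n (i + 2)
      + e δ n (i + 2) * e δ n (i + 1) * jm (i + 2) * e δ n (i + 2)
      - (∑ k : Fin (i + 2), δ ^ (k : ℕ) • jm (i + 1 - k))
      - e δ n (i + 2) * (∑ k : Fin (i + 1), δ ^ (k : ℕ) • jm (i - k))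
  termination_by i => i
  decreasing_by all_goals omega

/-- `p_0 = 0`, `p_1 = 1`, `p_{i+2} = δ p_{i+1} - p_i`. -/
def p : ℕ → S
  | 0 => 0
  | 1 => 1
  | i + 2 => δ * p (i + 1) - p i

variable {n}

/-- `r_𝔱(k)`. -/
def content {f : ℕ} (t : Tableau n f) (k : ℕ) : S :=
  if k ≤ 1 then 0
  else if t.entry k = t.entry (k - 1) + 1 then
    (p δ (t.entry k) - δ * p δ (t.entry k - 1)) * p δ (k - t.entry k + 1)
  else
    (p δ (k - t.entry k + 1) - δ * p δ (k - t.entry k)) * p δ (t.entry k)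

open Classical in
/-- `ℜ(k)`, the set of all `r_𝔱(k)` for `𝔱 ∈ 𝔗_k(μ)` and `μ` a partition of `k`. -/
noncomputable def contents (k : ℕ) : Finset S :=
  (Finset.range (k + 1)).biUnion fun j =>
    Finset.univ.image fun t : Tableau k j => content δ t k

end Algebra

/-! ### The orthogonal basis and the determinant -/

section Orthogonal

variable {K : Type*} [Field K] (δ : K) {n : ℕ}

open Classical in
/-- `F_𝔱 = ∏_{k=2}^n ∏_{r ∈ ℜ(k), r ≠ r_𝔱(k)} (T_k - r) / (r_𝔱(k) - r)`; the inner product is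
the value at `T_k` of a polynomial in one variable. -/
noncomputable def bigF {f : ℕ} (t : Tableau n f) : Alg δ n :=
  ((List.range' 2 (n - 1)).map fun k =>
    aeval (jm δ n k)
      (∏ r ∈ (contents δ k).erase (content δ t k),
        C (content δ t k - r)⁻¹ * (X - C r))).prod

/-- `f_𝔱 = m_𝔱 F_𝔱`. -/
noncomputable def fBasis {f : ℕ} (t : Tableau n f) : cellModule δ n f :=
  act (mBasis δ t) (bigF δ t)

variable (n)

/-- `det(λ) = ∏_𝔱 ⟨f_𝔱, f_𝔱⟩` for `λ = (f, n - 2f)`. -/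
noncomputable def det (f : ℕ) : K :=
  ∏ t : Tableau n f, cellForm δ n f (fBasis δ t) (fBasis δ t)

/-- `g_{λ,μ} = (p_{n-i-j+1} / p_{i-j})^{dim μ}` for `λ = (i, n - 2i)` and `μ = (j, n - 2j)`. -/
noncomputable def g (i j : ℕ) : K :=
  (p δ (n - i - j + 1) / p δ (i - j)) ^ dim n j

end Orthogonal

/-- The field of fractions of `ℤ[x]`. -/
abbrev F : Type := FractionRing ℤ[X]

/-- The indeterminate `x`, as an element of the field of fractions. -/
noncomputable def x : F := algebraMap ℤ[X] F X

end TemperleyLieb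

/-! Read a tableau as a lattice path with height `k - 2 * t.entry k` at time `k`; raising the first
entry is a down-step. Over a field `K` in which every `p (k + 1)` is nonzero, the cell module has a
seminormal model on functions on paths. The generator `e_{i+1}` sees only the paths that return at
time `i + 2` to their height at time `i`. There it mixes the peak and the valley by a rank-one block
whose trace is the parameter. These blocks satisfy the defining relations (`seminormal_sq`,
`seminormal_comm`, `seminormal_braid`), and every generator is self-adjoint for the diagonal form
with weights `norm t` (`form_seminormal`).

In this model the `m_k` with `k > f` act as zero, and `m_λ` acts by `v ↦ form v b • b`, where `b` is
the basis vector of the tableau `𝔱^λ` (`rmul_m_eq_form_smul`). Hence `m_λ a m_λ` is a scalar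
multiple of `m_λ` modulo the ideal, with the scalar given by `form`: the model form is the cell
form. This rests on two facts. The `m_λ v_𝔱` span, by rewriting words (`m_mul_mem_murphySpan`), and
their images in the model form a unitriangular matrix `U` (`det_murphyMatrix`), so they are
independent.

The Gram matrix is then `U D Uᵀ` with `D` the diagonal matrix of norms, and its determinant is the
product of the norms (`algebraMap_gramDet`). The Jucys--Murphy elements act diagonally (`rmul_jm`),
with eigenvalues that separate paths. So `F_𝔱` is a coordinate projection, `f_𝔱` becomes the basis
vector of `𝔱`, and its norm is `norm t` (`det_eq_prod_norm`).

Deleting the last step of a path gives a recursion for the product of the norms, and the product of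
the `g` obeys the same recursion (`prod_norm_succ`, `prod_g_succ`).

The model is set up for an algebra over `S` and a field `K` over `S`: the Gram determinant uses `S =
ℤ[x]`, while `det` uses `S = K`. -/

namespace TemperleyLieb

/-! ### Relations between generators, words and the elements `m` -/

section Relations

variable {S : Type*} [CommRing S] (δ : S) (n : ℕ)

theorem e_eq_zero {i : ℕ} (h : ¬(1 ≤ i ∧ i < n)) : e δ n i = 0 := dif_neg h

theorem e_mul_self (i : ℕ) : e δ n i * e δ n i = δ • e δ n i := by
  by_cases h : 1 ≤ i ∧ i < n
  · simp only [e, dif_pos h, ← map_mul, ← map_smul]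
    exact RingQuot.mkAlgHom_rel S (Rel.sq _)
  · simp [e_eq_zero δ n h]

theorem e_comm {i j : ℕ} (hij : i + 2 ≤ j ∨ j + 2 ≤ i) :
    e δ n i * e δ n j = e δ n j * e δ n i := by
  by_cases hi : 1 ≤ i ∧ i < n
  · by_cases hj : 1 ≤ j ∧ j < n
    · simp only [e, dif_pos hi, dif_pos hj, ← map_mul]
      exact RingQuot.mkAlgHom_rel S (Rel.comm _ _ (by simp only; omega))
    · simp [e_eq_zero δ n hj]
  · simp [e_eq_zero δ n hi]

theorem e_braid {i j : ℕ} (hj : 1 ≤ j ∧ j < n) (hij : i + 1 = j ∨ j + 1 = i) :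
    e δ n i * e δ n j * e δ n i = e δ n i := by
  by_cases hi : 1 ≤ i ∧ i < n
  · simp only [e, dif_pos hi, dif_pos hj, ← map_mul]
    exact RingQuot.mkAlgHom_rel S (Rel.braid _ _ (by simp only; omega))
  · simp [e_eq_zero δ n hi]

/-- A submodule that is stable under right multiplication by the generators is stable under right
multiplication by all elements. -/
theorem mul_mem_of_forall_e (N : Submodule S (Alg δ n))
    (h : ∀ y ∈ N, ∀ i, 1 ≤ i → i < n → y * e δ n i ∈ N) {y : Alg δ n} (hy : y ∈ N)
    (a : Alg δ n) : y * a ∈ N := by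
  obtain ⟨a, rfl⟩ := RingQuot.mkAlgHom_surjective S (Rel δ n) a
  induction a using FreeAlgebra.induction generalizing y with
  | grade0 r =>
    rw [AlgHom.commutes, ← Algebra.commutes, ← Algebra.smul_def]
    exact N.smul_mem r hy
  | grade1 i =>
    have := h y hy (i + 1) (by omega) (by omega)
    rwa [e, dif_pos (by omega)] at this
  | mul a b ha hb =>
    rw [map_mul, ← mul_assoc]
    exact hb (ha hy)
  | add a b ha hb =>
    rw [map_add, mul_add]
    exact N.add_mem (ha hy) (hb hy)

/-! ### The words `w` -/

@[simp] theorem w_self (i : ℕ) : w δ n i i = 1 := by simp [w]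

theorem w_succ_right {i j : ℕ} (h : i ≤ j) : w δ n i (j + 1) = w δ n i j * e δ n j := by
  rw [w, w, if_pos h, if_pos (by omega), show j + 1 - i = (j - i) + 1 by omega,
    List.range'_concat]
  simp [show i + (j - i) = j by omega]

theorem w_succ_left {i j : ℕ} (h : i < j) : w δ n i j = e δ n i * w δ n (i + 1) j := by
  rw [w, w, if_pos h.le, if_pos (by omega), show j - i = (j - (i + 1)) + 1 by omega,
    List.range'_succ]
  simp

theorem w_succ_left_desc {i j : ℕ} (h : i ≤ j) :
    w δ n (j + 1) i = e δ n j * w δ n j i := by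
  rcases h.eq_or_lt with rfl | h
  · simp [w]
  · rw [w, w, if_neg (by omega), if_neg (by omega), show j + 1 - i = (j - i) + 1 by omega,
      List.range'_concat]
    simp [show i + (j - i) = j by omega]

theorem w_mul_w {i j k : ℕ} (hij : i ≤ j) (hjk : j ≤ k) :
    w δ n i j * w δ n j k = w δ n i k := by
  induction k, hjk using Nat.le_induction with
  | base => simp
  | succ k hk ih => rw [w_succ_right δ n hk, w_succ_right δ n (hij.trans hk), ← mul_assoc, ih]

theorem commute_w {i j : ℕ} (hij : i ≤ j) {a : Alg δ n}
    (h : ∀ l, i ≤ l → l < j → Commute (e δ n l) a) : Commute (w δ n i j) a := by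
  induction j, hij using Nat.le_induction with
  | base => simp
  | succ j hj ih =>
    rw [w_succ_right δ n hj]
    exact (ih fun l hl hl' => h l hl (by omega)).mul_left (h j hj (by omega))

theorem commute_w_w {i j k l : ℕ} (hij : i ≤ j) (hjk : j + 1 ≤ k) (hkl : k ≤ l) :
    Commute (w δ n i j) (w δ n k l) := by
  refine commute_w δ n hij fun a _ ha' => (commute_w δ n hkl fun b hb _ => ?_).symm
  exact e_comm δ n (by omega)

/-- Right multiplication of an ascending word by one of its letters, not the last one. -/
theorem w_mul_e {i j k : ℕ} (hij : i ≤ j) (hjk : j + 2 ≤ k) (hk : k ≤ n) :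
    w δ n i k * e δ n j = w δ n (j + 2) k * w δ n i (j + 1) := by
  rw [← w_mul_w δ n (show i ≤ j by omega) (show j ≤ k by omega),
    w_succ_left δ n (show j < k by omega), w_succ_left δ n (show j + 1 < k by omega)]
  have h1 : Commute (w δ n (j + 2) k) (e δ n j) :=
    commute_w δ n hjk fun l hl _ => e_comm δ n (by omega)
  have h2 : Commute (w δ n i (j + 1)) (w δ n (j + 2) k) :=
    commute_w_w δ n (by omega) (by omega) hjk
  calc w δ n i j * (e δ n j * (e δ n (j + 1) * w δ n (j + 2) k)) * e δ n j
      = w δ n i j * (e δ n j * e δ n (j + 1) * (w δ n (j + 2) k * e δ n j)) := by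
        simp only [mul_assoc]
    _ = w δ n i j * (e δ n j * e δ n (j + 1) * e δ n j) * w δ n (j + 2) k := by
        rw [h1.eq]; simp only [mul_assoc]
    _ = w δ n i (j + 1) * w δ n (j + 2) k := by
        rw [e_braid δ n (by omega) (by omega), w_succ_right δ n hij]
    _ = _ := h2.eq

/-- Left multiplication of an ascending word by one of its letters, not one of the first two. -/
theorem e_mul_w {i j k : ℕ} (hi : 1 ≤ i) (hij : i + 2 ≤ j) (hjk : j < k) (hk : k ≤ n) :
    e δ n j * w δ n i k = w δ n j k * w δ n i (j - 1) := by
  obtain ⟨j, rfl⟩ : ∃ l, j = l + 1 := ⟨j - 1, by omega⟩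
  rw [← w_mul_w δ n (show i ≤ j by omega) (show j ≤ k by omega),
    w_succ_left δ n (show j < k by omega), w_succ_left δ n hjk, Nat.add_sub_cancel]
  have h1 : Commute (w δ n i j) (e δ n (j + 1)) :=
    commute_w δ n (by omega) fun l _ hl => e_comm δ n (by omega)
  have h2 : Commute (w δ n i j) (w δ n (j + 1) k) :=
    commute_w_w δ n (by omega) (by omega) (by omega)
  rw [w_succ_left δ n hjk] at h2
  calc e δ n (j + 1) * (w δ n i j * (e δ n j * (e δ n (j + 1) * w δ n (j + 1 + 1) k)))
      = (e δ n (j + 1) * w δ n i j) * (e δ n j * (e δ n (j + 1) * w δ n (j + 1 + 1) k)) := by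
        simp only [mul_assoc]
    _ = w δ n i j * ((e δ n (j + 1) * e δ n j * e δ n (j + 1)) * w δ n (j + 1 + 1) k) := by
        rw [← h1.eq]; simp only [mul_assoc]
    _ = _ := by rw [e_braid δ n (by omega) (by omega), h2.eq]

/-- Two ascending words of the normal form whose ends are not increasing can be exchanged. -/
theorem w_mul_w_exchange {b k l : ℕ} (hb : 1 ≤ b) (hk : b + 3 ≤ k) (hkl : k ≤ l) (hl : l ≤ n) :
    w δ n (b + 2) k * w δ n b l = w δ n (b + 2) l * w δ n b (k - 2) := by
  obtain ⟨k, rfl⟩ : ∃ j, k = j + 1 := ⟨k - 1, by omega⟩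
  -- The last letter of the first word, multiplied into the second, splits off an ascending word
  -- that prolongs the first one up to `l`.
  rw [w_succ_right δ n (by omega), mul_assoc, e_mul_w δ n hb (by omega) (by omega) hl, ← mul_assoc,
    w_mul_w δ n (by omega) (by omega)]
  rfl

/-! ### The elements `m` -/

@[simp] theorem m_zero : m δ n 0 = 1 := by simp [m]

theorem m_succ (f : ℕ) : m δ n (f + 1) = m δ n f * e δ n (2 * f + 1) := by
  simp [m, List.range_succ]

theorem commute_m {f : ℕ} {a : Alg δ n} (h : ∀ i < f, Commute (e δ n (2 * i + 1)) a) :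
    Commute (m δ n f) a := by
  induction f with
  | zero => simp
  | succ f ih =>
    rw [m_succ]
    exact (ih fun i hi => h i (by omega)).mul_left (h f (by omega))

theorem commute_m_e {f j : ℕ} (h : 2 * f + 1 ≤ j) : Commute (m δ n f) (e δ n j) :=
  commute_m δ n fun i hi => e_comm δ n (by omega)

theorem m_mem_checkIdeal {f k : ℕ} (hfk : f < k) (hk : 2 * k ≤ n) :
    m δ n k ∈ checkIdeal δ n f := by
  have h : cellIdeal δ n k ≤ checkIdeal δ n f :=
    le_iSup₂_of_le (f := fun k (_ : f < k ∧ 2 * k ≤ n) => cellIdeal δ n k) k ⟨hfk, hk⟩ le_rfl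
  exact h (TwoSidedIdeal.subset_span rfl)

/-- For `j = 2f + 1` the product is `m_{f+1}`, or zero when that generator does not exist. Larger
`j` follow from `e_{j+1} = e_{j+1} e_j e_{j+1}`, because `e_{j+1}` commutes with `m_f`. -/
theorem m_mul_e_mem_checkIdeal {f j : ℕ} (hj : 2 * f + 1 ≤ j) :
    m δ n f * e δ n j ∈ checkIdeal δ n f := by
  induction j, hj using Nat.le_induction with
  | base =>
    rw [← m_succ]
    by_cases h : 2 * f + 1 < n
    · exact m_mem_checkIdeal δ n (by omega) (by omega)
    · rw [m_succ, e_eq_zero δ n (by omega), mul_zero]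
      exact zero_mem _
  | succ j hj ih =>
    by_cases h : j < n
    · rw [← e_braid δ n (i := j + 1) (j := j) (by omega) (by omega), ← mul_assoc, ← mul_assoc,
        (commute_m_e δ n (show 2 * f + 1 ≤ j + 1 by omega)).eq, mul_assoc (e δ n (j + 1))]
      exact TwoSidedIdeal.mul_mem_right _ _ _ (TwoSidedIdeal.mul_mem_left _ _ _ ih)
    · rw [e_eq_zero δ n (by omega), mul_zero]
      exact zero_mem _

end Relations

/-! ### Tableaux as functions -/

namespace Tableau

variable {n f : ℕ}

theorem entry_of_le (t : Tableau n f) {k : ℕ} (h : k ≤ n) :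
    t.entry k = t.1 ⟨k, Nat.lt_succ_of_le h⟩ := dif_pos _

@[simp] theorem entry_zero (t : Tableau n f) : t.entry 0 = 0 := by
  rw [entry_of_le t (Nat.zero_le n)]
  exact t.2.1

theorem two_mul_entry_le (t : Tableau n f) (k : ℕ) : 2 * t.entry k ≤ k := by
  by_cases h : k ≤ n
  · rw [entry_of_le t h]
    exact t.2.2.1 _
  · simp [entry, show ¬ k < n + 1 by omega]

theorem entry_succ (t : Tableau n f) {k : ℕ} (h : k < n) :
    t.entry (k + 1) = t.entry k ∨ t.entry (k + 1) = t.entry k + 1 := by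
  rw [entry_of_le t h, entry_of_le t h.le]
  exact t.2.2.2.1 ⟨k, h⟩

@[simp] theorem entry_last (t : Tableau n f) : t.entry n = f := by
  rw [entry_of_le t le_rfl]
  exact t.2.2.2.2

theorem ext_entry {s t : Tableau n f} (h : ∀ k ≤ n, s.entry k = t.entry k) : s = t := by
  apply Subtype.ext
  funext k
  have := h k (Nat.le_of_lt_succ k.2)
  rwa [entry_of_le s (Nat.le_of_lt_succ k.2), entry_of_le t (Nat.le_of_lt_succ k.2)] at this

/-- The tableau with given entries. -/
def ofEntry (a : ℕ → ℕ) (h0 : a 0 = 0) (h2 : ∀ k ≤ n, 2 * a k ≤ k)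
    (hs : ∀ k < n, a (k + 1) = a k ∨ a (k + 1) = a k + 1) (hl : a n = f) : Tableau n f :=
  ⟨fun k => a k, h0, fun k => h2 k (by omega), fun k => hs k k.2, hl⟩

theorem entry_ofEntry {a : ℕ → ℕ} {h0 : a 0 = 0} {h2 : ∀ k ≤ n, 2 * a k ≤ k}
    {hs : ∀ k < n, a (k + 1) = a k ∨ a (k + 1) = a k + 1} {hl : a n = f} {k : ℕ} (h : k ≤ n) :
    (ofEntry a h0 h2 hs hl).entry k = a k := by
  rw [entry_of_le _ h]
  rfl

theorem entry_mono (t : Tableau n f) {j k : ℕ} (hjk : j ≤ k) (hk : k ≤ n) :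
    t.entry j ≤ t.entry k := by
  induction k, hjk using Nat.le_induction with
  | base => rfl
  | succ k _ ih =>
    have := ih (by omega)
    have := t.entry_succ (show k < n by omega)
    omega

end Tableau

/-! ### Spanning of the cell module -/

section Spanning

variable {S : Type*} [CommRing S] (δ : S) (n : ℕ)

/-- The word `w_{2b-1,k_b} ⋯ w_{3,k_2} w_{1,k_1}`. -/
noncomputable def normalWord (k : ℕ → ℕ) : ℕ → Alg δ n
  | 0 => 1
  | b + 1 => w δ n (2 * b + 1) (k (b + 1)) * normalWord k b

/-- The word `w_{2b,k_b} ⋯ w_{4,k_2} w_{2,k_1}`. -/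
noncomputable def shiftedWord (k : ℕ → ℕ) : ℕ → Alg δ n
  | 0 => 1
  | b + 1 => w δ n (2 * (b + 1)) (k (b + 1)) * shiftedWord k b

variable {n} in
/-- The ends of the words in `normalWord`. -/
def ValidEnds (n f : ℕ) (k : ℕ → ℕ) : Prop := ∀ b, 1 ≤ b → b ≤ f → 2 * b ≤ k b ∧ k b ≤ n

/-- The first letter `e_{2b+1}` of each block can be pulled to the far left: the other letters of
the block have index at least `2b + 2` and commute with `m_b`. -/
theorem normalWord_eq {f : ℕ} {k : ℕ → ℕ} (hk : ValidEnds n f k) {b : ℕ} (hb : b ≤ f) :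
    normalWord δ n k b = m δ n b * shiftedWord δ n k b := by
  induction b with
  | zero => simp [normalWord, shiftedWord]
  | succ b ih =>
    have h := (hk (b + 1) (by omega) hb).1
    rw [normalWord, ih (by omega), w_succ_left δ n (by omega), shiftedWord, m_succ]
    have h1 : Commute (w δ n (2 * b + 1 + 1) (k (b + 1))) (m δ n b) :=
      commute_w δ n (by omega) fun l hl _ => (commute_m_e δ n (by omega)).symm
    have h2 : Commute (m δ n b) (e δ n (2 * b + 1)) := commute_m_e δ n le_rfl
    rw [h2.eq, mul_assoc, ← mul_assoc _ (m δ n b), h1.eq]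
    simp only [mul_assoc]
    rfl

theorem normalWord_congr {k k' : ℕ → ℕ} {b : ℕ} (h : ∀ c, 1 ≤ c → c ≤ b → k c = k' c) :
    normalWord δ n k b = normalWord δ n k' b := by
  induction b with
  | zero => rfl
  | succ b ih =>
    rw [normalWord, normalWord, h (b + 1) (by omega) le_rfl, ih fun c hc hc' => h c hc (by omega)]

/-- A normal word with strictly increasing ends comes from a tableau. -/
theorem exists_tableau_of_strictMono {f : ℕ} {k : ℕ → ℕ} (hk : ValidEnds n f k)
    (hlt : ∀ b, 1 ≤ b → b + 1 ≤ f → k b < k (b + 1)) :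
    ∃ t : Tableau n f, normalWord δ n k f = m δ n f * v δ t := by
  have hmono : ∀ b c, 1 ≤ b → b ≤ c → c ≤ f → k b + (c - b) ≤ k c := by
    intro b c hb hbc
    induction c, hbc using Nat.le_induction with
    | base => intro; simp
    | succ c hc ih =>
      intro h
      have := hlt c (by omega) h
      have := ih (by omega)
      omega
  -- The ends `k b` are the times of the down-steps, so the first entry at time `l` counts the ends
  -- up to `l`.
  let a : ℕ → ℕ := fun l => ((Finset.Icc 1 f).filter fun b => k b ≤ l).card
  have hset : ∀ l, (Finset.Icc 1 f).filter (fun b => k b ≤ l) = Finset.Icc 1 (a l) := by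
    intro l
    have : ∃ c ≤ f, (Finset.Icc 1 f).filter (fun b => k b ≤ l) = Finset.Icc 1 c := by
      by_cases hne : ((Finset.Icc 1 f).filter (fun b => k b ≤ l)).Nonempty
      · refine ⟨((Finset.Icc 1 f).filter (fun b => k b ≤ l)).max' hne, ?_, ?_⟩
        · have := Finset.max'_mem _ hne
          simp only [Finset.mem_filter, Finset.mem_Icc] at this
          omega
        · have h1 := Finset.max'_mem _ hne
          ext b
          constructor
          · intro hb
            have h2 := Finset.le_max' _ b hb
            simp only [Finset.mem_filter, Finset.mem_Icc] at hb ⊢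
            omega
          · intro hb
            simp only [Finset.mem_filter, Finset.mem_Icc] at h1 hb ⊢
            have := hmono b _ hb.1 hb.2 (by omega)
            omega
      · exact ⟨0, by omega, by simpa using Finset.not_nonempty_iff_eq_empty.1 hne⟩
    obtain ⟨c, -, hc⟩ := this
    have : a l = c := by simp only [a, hc]; simp
    rw [hc, this]
  have hiff : ∀ l b, 1 ≤ b → b ≤ f → (b ≤ a l ↔ k b ≤ l) := by
    intro l b hb hb'
    have := congrArg (b ∈ ·) (hset l)
    simp only [Finset.mem_filter, Finset.mem_Icc, eq_iff_iff] at this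
    constructor
    · intro h; exact (this.2 ⟨hb, h⟩).2
    · intro h; exact (this.1 ⟨⟨hb, hb'⟩, h⟩).2
  have haf : ∀ l, a l ≤ f := by
    intro l
    have := Finset.card_filter_le (Finset.Icc 1 f) (fun b => k b ≤ l)
    simpa using this
  have h2 : ∀ l ≤ n, 2 * a l ≤ l := by
    intro l _
    rcases Nat.eq_zero_or_pos (a l) with h | h
    · omega
    · have h1 := (hiff l (a l) h (haf l)).1 le_rfl
      have h2 := (hk (a l) h (haf l)).1
      omega
  have hs : ∀ l < n, a (l + 1) = a l ∨ a (l + 1) = a l + 1 := by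
    intro l _
    have h1 : a l ≤ a (l + 1) := by
      rcases Nat.eq_zero_or_pos (a l) with h | h
      · omega
      · exact (hiff _ _ h (haf l)).2 (((hiff l _ h (haf l)).1 le_rfl).trans (Nat.le_succ l))
    by_contra hcon
    have h3 := haf (l + 1)
    -- A jump by two or more would force `l < k (a l + 1) < k (a l + 2) ≤ l + 1`.
    have h4 := (hiff (l + 1) (a l + 2) (by omega) (by omega)).1 (by omega)
    have h5 := mt (hiff l (a l + 1) (by omega) (by omega)).2 (by omega)
    have h6 := hlt (a l + 1) (by omega) (by omega)
    have : a l + 1 + 1 = a l + 2 := rfl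
    rw [this] at h6
    omega
  have hl : a n = f := by
    apply le_antisymm (haf n)
    rcases Nat.eq_zero_or_pos f with h | h
    · omega
    · exact (hiff n f h le_rfl).2 (hk f h le_rfl).2
  let t : Tableau n f := Tableau.ofEntry a (by have := h2 0 (by omega); omega) h2 hs hl
  refine ⟨t, ?_⟩
  have key : ∀ l ≤ n, vAux δ n t.entry l = shiftedWord δ n k (a l) := by
    intro l
    induction l with
    | zero =>
      intro _
      have := h2 0 (by omega)
      rw [show a 0 = 0 by omega]
      rfl
    | succ l ih =>
      intro hl
      rw [vAux, Tableau.entry_ofEntry hl, Tableau.entry_ofEntry (by omega), ih (by omega)]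
      rcases hs l (by omega) with h | h
      · rw [if_pos h, h]
      · rw [if_neg (by omega), h, shiftedWord]
        have h3 := haf (l + 1)
        have h4 := (hiff (l + 1) (a l + 1) (by omega) (by omega)).1 (by omega)
        have h5 := mt (hiff l (a l + 1) (by omega) (by omega)).2 (by omega)
        rw [show k (a l + 1) = l + 1 by omega]
  rw [normalWord_eq δ n hk le_rfl, v, key n le_rfl, hl]

/-- At a place where the ends fail to increase, `w_mul_w_exchange` replaces the pair `(k b, k (b +
1))` by `(k (b + 1) - 2, k b)`. The word is unchanged and the sum of the ends drops by two, so the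
process stops at strictly increasing ends. -/
theorem exists_tableau_normalWord {f : ℕ} (k : ℕ → ℕ) (hk : ValidEnds n f k) :
    ∃ t : Tableau n f, normalWord δ n k f = m δ n f * v δ t := by
  induction h : ∑ b ∈ Finset.Icc 1 f, k b using Nat.strong_induction_on generalizing k with
  | _ N ih =>
    by_cases hlt : ∀ b, 1 ≤ b → b + 1 ≤ f → k b < k (b + 1)
    · exact exists_tableau_of_strictMono δ n hk hlt
    push Not at hlt
    obtain ⟨b, hb, hbf, hle⟩ := hlt
    have h1 := hk (b + 1) (by omega) hbf
    have h0 := hk b hb (by omega)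
    let k' : ℕ → ℕ := fun c => if c = b + 1 then k b else if c = b then k (b + 1) - 2 else k c
    have hk' : ValidEnds n f k' := by
      intro c hc hc'
      have := hk c hc hc'
      simp only [k']
      split_ifs <;> omega
    have hsum : ∑ c ∈ Finset.Icc 1 f, k' c < N := by
      rw [← h]
      have hmem : b ∈ Finset.Icc 1 f := Finset.mem_Icc.2 ⟨hb, by omega⟩
      have hmem' : b + 1 ∈ (Finset.Icc 1 f).erase b := by simp; omega
      rw [← Finset.add_sum_erase _ _ hmem, ← Finset.add_sum_erase _ k hmem,
        ← Finset.add_sum_erase _ _ hmem', ← Finset.add_sum_erase _ k hmem']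
      have : ∑ c ∈ ((Finset.Icc 1 f).erase b).erase (b + 1), k' c =
          ∑ c ∈ ((Finset.Icc 1 f).erase b).erase (b + 1), k c := by
        apply Finset.sum_congr rfl
        intro c hc
        simp only [Finset.mem_erase] at hc
        simp [k', hc.1, hc.2.1]
      rw [this]
      have e1 : k' b = k (b + 1) - 2 := by simp [k']
      have e2 : k' (b + 1) = k b := by simp [k']
      omega
    have heq : ∀ c, b + 1 ≤ c → normalWord δ n k c = normalWord δ n k' c := by
      intro c hc
      induction c, hc using Nat.le_induction with
      | base =>
        obtain ⟨b, rfl⟩ : ∃ c, b = c + 1 := ⟨b - 1, by omega⟩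
        have e1 : k' (b + 1) = k (b + 1 + 1) - 2 := by simp [k']
        have e2 : k' (b + 1 + 1) = k (b + 1) := by simp [k']
        rw [normalWord, normalWord, normalWord, normalWord, ← mul_assoc, ← mul_assoc, e1, e2,
          show 2 * (b + 1) + 1 = 2 * b + 1 + 2 by ring,
          w_mul_w_exchange δ n (by omega) (by omega) hle (by omega),
          normalWord_congr δ n (k' := k') (b := b)]
        intro c hc hc'
        simp [k', show c ≠ b + 1 by omega, show c ≠ b + 1 + 1 by omega]
      | succ c hc ihc =>
        rw [normalWord, normalWord, ihc]
        simp [k', show c ≠ b by omega, show c + 1 ≠ b by omega]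
    rw [heq f hbf]
    exact ih _ hsum k' hk' rfl

/-- The elements `a` with `a m_λ` in the ideal `checkIdeal`. -/
noncomputable def leftAnnihilator (f : ℕ) : Submodule S (Alg δ n) where
  carrier := {a | a * m δ n f ∈ checkIdeal δ n f}
  add_mem' ha hb := by
    simp only [Set.mem_ofPred_eq, add_mul] at *
    exact add_mem ha hb
  zero_mem' := by simp [zero_mem]
  smul_mem' r a ha := by
    simp only [Set.mem_ofPred_eq] at *
    rw [Algebra.smul_def, mul_assoc]
    exact TwoSidedIdeal.mul_mem_left _ _ _ ha

/-- The left factors of the normal words that consist of the last `d` blocks, together with the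
error terms. -/
noncomputable def blockSpan (f : ℕ) : ℕ → Submodule S (Alg δ n)
  | 0 => Submodule.span S {1} ⊔ leftAnnihilator δ n f
  | d + 1 => Submodule.span S
      {a | ∃ y ∈ blockSpan f d, ∃ k, 2 * (f - d) ≤ k ∧ k ≤ n ∧ a = y * w δ n (2 * (f - d) - 1) k}

theorem mul_w_mem {N : Submodule S (Alg δ n)} {i j : ℕ} (hij : i ≤ j)
    (h : ∀ y ∈ N, ∀ l, i ≤ l → l < j → y * e δ n l ∈ N) {y : Alg δ n} (hy : y ∈ N) :
    y * w δ n i j ∈ N := by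
  induction j, hij using Nat.le_induction with
  | base => simpa
  | succ j hj ih =>
    rw [w_succ_right δ n hj, ← mul_assoc]
    exact h _ (ih fun y hy l hl hl' => h y hy l hl (by omega)) _ hj (by omega)

/-- Multiplied onto the rightmost block, a letter rescales it, prolongs it, commutes past it, or
shortens it. In the last two cases the letters that emerge on its left have index large enough to be
absorbed by the earlier blocks, by induction. With no blocks left, the letter lands in
`leftAnnihilator`, by `m_mul_e_mem_checkIdeal`. -/
theorem blockSpan_mul_e {f d : ℕ} (hd : d ≤ f) {i : ℕ} (hi : 2 * (f - d) + 1 ≤ i) (hin : i < n)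
    {y : Alg δ n} (hy : y ∈ blockSpan δ n f d) : y * e δ n i ∈ blockSpan δ n f d := by
  induction d generalizing i y with
  | zero =>
    rw [blockSpan] at hy ⊢
    obtain ⟨a, ha, b, hb, rfl⟩ := Submodule.mem_sup.1 hy
    obtain ⟨r, rfl⟩ := Submodule.mem_span_singleton.1 ha
    apply Submodule.mem_sup_right
    have hc := commute_m_e δ n (show 2 * f + 1 ≤ i by omega)
    change (r • 1 + b) * e δ n i * m δ n f ∈ checkIdeal δ n f
    rw [add_mul, add_mul, mul_assoc b, ← hc.eq, mul_assoc (r • 1), ← hc.eq, ← mul_assoc b]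
    exact add_mem (TwoSidedIdeal.mul_mem_left _ _ _ (m_mul_e_mem_checkIdeal δ n (by omega)))
      (TwoSidedIdeal.mul_mem_right _ _ _ hb)
  | succ d ih =>
    rw [blockSpan] at hy ⊢
    have ih' : ∀ z ∈ blockSpan δ n f d, ∀ l, 2 * (f - d) + 1 ≤ l → l < n →
        z * e δ n l ∈ blockSpan δ n f d := fun z hz l hl hl' => ih (by omega) hl hl' hz
    induction hy using Submodule.span_induction with
    | zero => simp
    | add a b _ _ ha hb => rw [add_mul]; exact add_mem ha hb
    | smul r a _ ha => rw [smul_mul_assoc]; exact Submodule.smul_mem _ _ ha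
    | mem a ha =>
      obtain ⟨y, hy, k, hk, hkn, rfl⟩ := ha
      rw [mul_assoc]
      rcases lt_trichotomy i k with hik | rfl | hik
      · rcases (show i + 1 = k ∨ i + 2 ≤ k by omega) with rfl | hik
        · rw [w_succ_right δ n (by omega), mul_assoc, e_mul_self, mul_smul_comm, mul_smul_comm,
            ← w_succ_right δ n (by omega)]
          exact Submodule.smul_mem _ _ (Submodule.subset_span ⟨y, hy, _, hk, hkn, rfl⟩)
        · rw [w_mul_e δ n (by omega) hik hkn, ← mul_assoc]
          refine Submodule.subset_span ⟨_, ?_, i + 1, by omega, by omega, rfl⟩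
          exact mul_w_mem δ n hik (fun z hz l hl hl' => ih' z hz l (by omega) (by omega)) hy
      · rw [← w_succ_right δ n (by omega)]
        exact Submodule.subset_span ⟨y, hy, i + 1, by omega, by omega, rfl⟩
      · have : Commute (w δ n (2 * (f - d) - 1) k) (e δ n i) :=
          commute_w δ n (by omega) fun l _ hl => e_comm δ n (by omega)
        rw [this.eq, ← mul_assoc]
        exact Submodule.subset_span ⟨_, ih' y hy i (by omega) hin, k, hk, hkn, rfl⟩

/-- The linear span of the elements `m_λ v_𝔱` and of the ideal `checkIdeal`. -/
noncomputable def murphySpan (f : ℕ) : Submodule S (Alg δ n) where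
  carrier := {a | toQuo δ n f a ∈
    Submodule.span S (Set.range fun t : Tableau n f => toQuo δ n f (m δ n f * v δ t))}
  add_mem' ha hb := by
    simp only [Set.mem_ofPred_eq, map_add] at *
    exact add_mem ha hb
  zero_mem' := by simp
  smul_mem' r a ha := by
    simp only [Set.mem_ofPred_eq] at *
    exact Submodule.smul_mem _ r ha

theorem mem_murphySpan {f : ℕ} {a : Alg δ n} : a ∈ murphySpan δ n f ↔ toQuo δ n f a ∈
    Submodule.span S (Set.range fun t : Tableau n f => toQuo δ n f (m δ n f * v δ t)) := Iff.rfl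

theorem toQuo_eq_zero {f : ℕ} {a : Alg δ n} : toQuo δ n f a = 0 ↔ a ∈ checkIdeal δ n f := by
  rw [← TwoSidedIdeal.mem_ker, toQuo, TwoSidedIdeal.ker_ringCon_mk']

/-- The rightmost block of the left factor is moved into the normal word by changing one end, which
is why `k` must stay arbitrary in the induction. At `d = 0` there remain a scalar multiple of a full
normal word and an error term killed through the factor `m_λ`. -/
theorem blockSpan_mul_normalWord {f d : ℕ} (hd : d ≤ f) {k : ℕ → ℕ} (hk : ValidEnds n f k)
    {y : Alg δ n} (hy : y ∈ blockSpan δ n f d) :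
    y * normalWord δ n k (f - d) ∈ murphySpan δ n f := by
  induction d generalizing y k with
  | zero =>
    rw [blockSpan] at hy
    obtain ⟨a, ha, b, hb, rfl⟩ := Submodule.mem_sup.1 hy
    obtain ⟨r, rfl⟩ := Submodule.mem_span_singleton.1 ha
    rw [add_mul]
    refine add_mem ?_ ?_
    · rw [smul_mul_assoc, one_mul]
      refine Submodule.smul_mem _ _ ?_
      obtain ⟨t, ht⟩ := exists_tableau_normalWord δ n k hk
      exact (mem_murphySpan δ n).2 (Submodule.subset_span ⟨t, by simp only [Nat.sub_zero, ht]⟩)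
    · have : b * normalWord δ n k (f - 0) ∈ checkIdeal δ n f := by
        rw [Nat.sub_zero, normalWord_eq δ n hk le_rfl, ← mul_assoc]
        exact TwoSidedIdeal.mul_mem_right _ _ _ hb
      rw [mem_murphySpan, (toQuo_eq_zero δ n).2 this]
      exact zero_mem _
  | succ d ih =>
    rw [blockSpan] at hy
    induction hy using Submodule.span_induction with
    | zero => simp
    | add a b _ _ ha hb => rw [add_mul]; exact add_mem ha hb
    | smul r a _ ha => rw [smul_mul_assoc]; exact Submodule.smul_mem _ _ ha
    | mem a ha =>
      obtain ⟨y, hy, l, hl, hln, rfl⟩ := ha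
      obtain ⟨c, hc⟩ : ∃ c, f - d = c + 1 := ⟨f - d - 1, by omega⟩
      have hk' : ValidEnds n f (Function.update k (f - d) l) := by
        intro b hb hb'
        rcases eq_or_ne b (f - d) with rfl | h
        · simpa using ⟨hl, hln⟩
        · simpa [Function.update_of_ne h] using hk b hb hb'
      have := ih (by omega) hk' hy
      rw [hc, normalWord, ← mul_assoc, Function.update_self,
        normalWord_congr δ n (k' := k)] at this
      · rw [show f - (d + 1) = c by omega, hc]
        exact this
      · intro b hb hb'
        rw [Function.update_of_ne (by omega)]

/-- With ends `2 * b` every block is the single letter `e_{2b-1}` and the word is `m_λ`. Peeling off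
all blocks places `m_λ` itself in `blockSpan`. -/
theorem exists_normalWord_eq_mul {f d : ℕ} (hf : 2 * f ≤ n) (hd : d ≤ f) :
    ∃ y ∈ blockSpan δ n f d,
      normalWord δ n (fun b => 2 * b) f = y * normalWord δ n (fun b => 2 * b) (f - d) := by
  induction d with
  | zero =>
    exact ⟨1, Submodule.mem_sup_left (Submodule.mem_span_singleton_self _), by simp⟩
  | succ d ih =>
    obtain ⟨y, hy, h⟩ := ih (by omega)
    obtain ⟨c, hc⟩ : ∃ c, f - d = c + 1 := ⟨f - d - 1, by omega⟩
    refine ⟨y * w δ n (2 * (f - d) - 1) (2 * (f - d)),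
      Submodule.subset_span ⟨y, hy, _, le_rfl, by omega, rfl⟩, ?_⟩
    rw [h, mul_assoc, hc, normalWord, show f - (d + 1) = c by omega]
    rfl

theorem shiftedWord_two_mul (b : ℕ) : shiftedWord δ n (fun b => 2 * b) b = 1 := by
  induction b with
  | zero => rfl
  | succ b ih => simp [shiftedWord, ih]

/-- Every multiple of `m_λ` is a combination of the `m_λ v_𝔱` modulo `checkIdeal`. -/
theorem m_mul_mem_murphySpan {f : ℕ} (hf : 2 * f ≤ n) (a : Alg δ n) :
    m δ n f * a ∈ murphySpan δ n f := by
  have hk : ValidEnds n f fun b => 2 * b := fun b _ hb => ⟨le_rfl, by dsimp only; omega⟩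
  have hm : m δ n f ∈ blockSpan δ n f f := by
    obtain ⟨y, hy, h⟩ := exists_normalWord_eq_mul δ n hf (d := f) le_rfl
    rw [normalWord_eq δ n hk le_rfl, shiftedWord_two_mul, mul_one, Nat.sub_self, normalWord,
      mul_one] at h
    rwa [h]
  have := mul_mem_of_forall_e δ n (blockSpan δ n f f)
    (fun y hy i hi hin => blockSpan_mul_e δ n le_rfl (by omega) hin hy) hm a
  simpa [normalWord] using blockSpan_mul_normalWord δ n le_rfl hk this

end Spanning

/-! ### Local moves on tableaux -/

namespace Tableau

variable {n f : ℕ}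

/-- The path of `t` returns at the time `i + 2` to the height it has at the time `i`. -/
def Turn (i : ℕ) (t : Tableau n f) : Prop := i + 2 ≤ n ∧ t.entry (i + 2) = t.entry i + 1

instance (i : ℕ) (t : Tableau n f) : Decidable (Turn i t) := instDecidableAnd

/-- The path of `t` turns between `i` and `i + 2` at a positive height. -/
def Flippable (i : ℕ) (t : Tableau n f) : Prop := Turn i t ∧ 2 * t.entry i + 1 ≤ i

instance (i : ℕ) (t : Tableau n f) : Decidable (Flippable i t) := instDecidableAnd

theorem Turn.entry_succ {i : ℕ} {t : Tableau n f} (h : Turn i t) :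
    t.entry (i + 1) = t.entry i ∨ t.entry (i + 1) = t.entry i + 1 :=
  Tableau.entry_succ t (by have := h.1; omega)

/-- Exchange of a peak and a valley at the time `i + 1`. -/
noncomputable def flip (i : ℕ) (t : Tableau n f) : Tableau n f :=
  if h : Flippable i t then
    -- The two possible entries at time `i + 1` are `t.entry i` and `t.entry i + 1`; subtracting one
    -- from their sum gives the other.
    ofEntry (fun k => if k = i + 1 then 2 * t.entry i + 1 - t.entry (i + 1) else t.entry k)
      (by simp)
      (by
        intro k hk
        have h1 := h.1.entry_succ
        have h2 := h.2
        have h3 := t.two_mul_entry_le k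
        split_ifs <;> omega)
      (by
        intro k hk
        have h1 := h.1.entry_succ
        have h2 := h.1.2
        have h3 := Tableau.entry_succ t hk
        have h4 : k = i ∨ k = i + 1 ∨ (k ≠ i ∧ k ≠ i + 1) := by omega
        rcases h4 with rfl | rfl | ⟨h4, h5⟩
        · simp; omega
        · simp only [if_pos, if_neg (show ¬ (i + 1 + 1 = i + 1) by omega),
            show i + 1 + 1 = i + 2 from rfl]
          omega
        · simpa [h4, h5] using h3)
      (by
        have := h.1.1
        simp [show n ≠ i + 1 by omega])
  -- The default makes `flip i` an involution of all tableaux, along which sums can be reindexed.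
  else t

theorem flip_of_not {i : ℕ} {t : Tableau n f} (h : ¬ Flippable i t) : flip i t = t := dif_neg h

theorem entry_flip_of_ne {i k : ℕ} (t : Tableau n f) (h : k ≠ i + 1) :
    (flip i t).entry k = t.entry k := by
  by_cases hf : Flippable i t
  · by_cases hk : k ≤ n
    · rw [flip, dif_pos hf, entry_ofEntry hk, if_neg h]
    · simp [entry, show ¬ k < n + 1 by omega]
  · rw [flip_of_not hf]

theorem entry_flip_self {i : ℕ} {t : Tableau n f} (h : Flippable i t) :
    (flip i t).entry (i + 1) = 2 * t.entry i + 1 - t.entry (i + 1) := by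
  have := h.1.1
  rw [flip, dif_pos h, entry_ofEntry (by omega), if_pos rfl]

theorem turn_flip {i : ℕ} {t : Tableau n f} : Turn i (flip i t) ↔ Turn i t := by
  simp [Turn, entry_flip_of_ne t (show i + 2 ≠ i + 1 by omega),
    entry_flip_of_ne t (show i ≠ i + 1 by omega)]

theorem flippable_flip {i : ℕ} {t : Tableau n f} : Flippable i (flip i t) ↔ Flippable i t := by
  simp [Flippable, turn_flip, entry_flip_of_ne t (show i ≠ i + 1 by omega)]

@[simp] theorem flip_flip_self (i : ℕ) (t : Tableau n f) : flip i (flip i t) = t := by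
  by_cases h : Flippable i t
  · apply ext_entry
    intro k hk
    by_cases hki : k = i + 1
    · subst hki
      have := h.1.entry_succ
      rw [entry_flip_self (flippable_flip.2 h), entry_flip_self h, entry_flip_of_ne t (by omega)]
      omega
    · rw [entry_flip_of_ne _ hki, entry_flip_of_ne _ hki]
  · rw [flip_of_not h, flip_of_not h]

theorem turn_flip_of_far {i j : ℕ} (t : Tableau n f) (h : i + 2 ≤ j ∨ j + 2 ≤ i) :
    Turn i (flip j t) ↔ Turn i t := by
  simp [Turn, entry_flip_of_ne t (show i + 2 ≠ j + 1 by omega),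
    entry_flip_of_ne t (show i ≠ j + 1 by omega)]

theorem flippable_flip_of_far {i j : ℕ} (t : Tableau n f) (h : i + 2 ≤ j ∨ j + 2 ≤ i) :
    Flippable i (flip j t) ↔ Flippable i t := by
  simp [Flippable, turn_flip_of_far t h, entry_flip_of_ne t (show i ≠ j + 1 by omega)]

theorem flip_comm {i j : ℕ} (t : Tableau n f) (h : i + 2 ≤ j ∨ j + 2 ≤ i) :
    flip i (flip j t) = flip j (flip i t) := by
  by_cases hi : Flippable i t
  · by_cases hj : Flippable j t
    · apply ext_entry
      intro k _
      by_cases hki : k = i + 1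
      · subst hki
        rw [entry_flip_self ((flippable_flip_of_far t h).2 hi), entry_flip_of_ne _ (by omega),
          entry_flip_of_ne _ (by omega), entry_flip_of_ne _ (by omega), entry_flip_self hi]
      · by_cases hkj : k = j + 1
        · subst hkj
          rw [entry_flip_self ((flippable_flip_of_far t h.symm).2 hj), entry_flip_of_ne _ hki,
            entry_flip_of_ne _ hki, entry_flip_self hj, entry_flip_of_ne _ (by omega)]
        · simp only [entry_flip_of_ne _ hki, entry_flip_of_ne _ hkj]
    · rw [flip_of_not hj, flip_of_not (mt (flippable_flip_of_far t h.symm).1 hj)]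
  · rw [flip_of_not hi, flip_of_not (mt (flippable_flip_of_far t h).1 hi)]

end Tableau

/-! ### The polynomials `p` -/

section P

variable {S : Type*} [CommRing S] (δ : S)

theorem p_add_two (i : ℕ) : p δ (i + 2) = δ * p δ (i + 1) - p δ i := rfl

@[simp] theorem p_zero : p δ 0 = 0 := rfl

@[simp] theorem p_one : p δ 1 = 1 := rfl

theorem p_two : p δ 2 = δ := by simp [p_add_two]

/-- This is a Casoratian of two solutions of the same recursion, hence independent of `a`; at `a =
0` it is `p m`. It governs all differences of eigenvalues below. -/
theorem p_mul_sub (a m : ℕ) :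
    p δ (a + 1) * p δ (a + m) - p δ a * p δ (a + m + 1) = p δ m := by
  induction a with
  | zero => simp
  | succ a ih =>
    rw [← ih, p_add_two, show a + 1 + m + 1 = a + m + 2 by ring, p_add_two,
      show a + 1 + m = a + m + 1 by ring]
    ring

theorem map_p {T : Type*} [CommRing T] (g : S →+* T) (i : ℕ) : g (p δ i) = p (g δ) i := by
  induction i using Nat.twoStepInduction with
  | zero => simp
  | one => simp
  | more i h1 h2 => rw [p_add_two, p_add_two, map_sub, map_mul, h1, h2]

end P

/-! ### The seminormal form -/

section Seminormal

open Tableau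

variable {K : Type*} [Field K] (δ : K) {n f : ℕ}

/-- The diagonal coefficients of the generators in the seminormal form. -/
noncomputable def diagCoeff (i : ℕ) (t : Tableau n f) : K :=
  if t.entry (i + 1) = t.entry i then
    p δ (i - 2 * t.entry i + 2) / p δ (i - 2 * t.entry i + 1)
  else p δ (i - 2 * t.entry i) / p δ (i - 2 * t.entry i + 1)

open Classical in
/-- The off-diagonal coefficients of the generators in the seminormal form. -/
noncomputable def flipCoeff (i : ℕ) (t : Tableau n f) : K :=
  if t.entry (i + 1) = t.entry i then (if Flippable i t then 1 else 0)
  else p δ (i - 2 * t.entry i) * p δ (i - 2 * t.entry i + 2) / p δ (i - 2 * t.entry i + 1) ^ 2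

/-- The action of the generator `e_{i+1}` in the seminormal form. -/
noncomputable def seminormal (i : ℕ) :
    (Tableau n f → K) →ₗ[K] (Tableau n f → K) where
  toFun v t := if Turn i t then diagCoeff δ i t * v t + flipCoeff δ i t * v (flip i t) else 0
  map_add' v w := by
    funext t
    dsimp only [Pi.add_apply]
    split_ifs <;> ring
  map_smul' r v := by
    funext t
    dsimp only [Pi.smul_apply, smul_eq_mul, RingHom.id_apply]
    split_ifs <;> ring

theorem seminormal_of_turn {i : ℕ} {t : Tableau n f} (h : Turn i t) (v : Tableau n f → K) :
    seminormal δ i v t = diagCoeff δ i t * v t + flipCoeff δ i t * v (flip i t) := if_pos h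

theorem seminormal_of_not_turn {i : ℕ} {t : Tableau n f} (h : ¬ Turn i t)
    (v : Tableau n f → K) : seminormal δ i v t = 0 := if_neg h

variable {δ}

/-- A path at height zero can only go up, so its turn is a peak with no valley to pair with. -/
theorem not_flippable {i : ℕ} {t : Tableau n f} (ht : Turn i t) (h : ¬ Flippable i t) :
    i = 2 * t.entry i ∧ t.entry (i + 1) = t.entry i := by
  have h1 := t.two_mul_entry_le i
  have h2 := t.two_mul_entry_le (i + 1)
  have h3 := ht.entry_succ
  have h4 : ¬ (2 * t.entry i + 1 ≤ i) := fun h' => h ⟨ht, h'⟩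
  omega

theorem coeff_of_not_flippable {i : ℕ} {t : Tableau n f} (ht : Turn i t)
    (h : ¬ Flippable i t) : diagCoeff δ i t = δ ∧ flipCoeff δ i t = 0 := by
  obtain ⟨h1, h2⟩ := not_flippable ht h
  have h3 : i - 2 * t.entry i = 0 := by omega
  simp [diagCoeff, flipCoeff, h2, h, h3, p_two]

theorem entry_flip_peak {i : ℕ} {t : Tableau n f} (h : Flippable i t)
    (hp : t.entry (i + 1) = t.entry i) : (flip i t).entry (i + 1) = t.entry i + 1 := by
  rw [entry_flip_self h, hp]; omega

theorem entry_flip_valley {i : ℕ} {t : Tableau n f} (h : Flippable i t)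
    (hp : t.entry (i + 1) ≠ t.entry i) : (flip i t).entry (i + 1) = t.entry i := by
  have := h.1.entry_succ
  rw [entry_flip_self h]; omega

/-- The trace of the block on a peak and its valley: with `h` the height at time `i`, this is `p (h
+ 2) + p h = δ * p (h + 1)`. -/
theorem diagCoeff_add (hP : ∀ k, p δ (k + 1) ≠ 0) {i : ℕ} {t : Tableau n f}
    (h : Flippable i t) : diagCoeff δ i t + diagCoeff δ i (flip i t) = δ := by
  have h0 := entry_flip_of_ne t (show i ≠ i + 1 by omega)
  have := hP (i - 2 * t.entry i)
  by_cases hp : t.entry (i + 1) = t.entry i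
  · simp only [diagCoeff, h0, entry_flip_peak h hp, if_pos hp, if_neg (Nat.succ_ne_self _),
      p_add_two]
    field_simp
    ring
  · simp only [diagCoeff, h0, entry_flip_valley h hp, if_neg hp, if_true, p_add_two]
    field_simp
    ring

/-- The block has determinant zero. Only the product of the off-diagonal coefficients is forced;
giving the peak the coefficient `1` is what later makes the Murphy vectors unitriangular. -/
theorem flipCoeff_mul (hP : ∀ k, p δ (k + 1) ≠ 0) {i : ℕ} {t : Tableau n f}
    (h : Flippable i t) :
    flipCoeff δ i t * flipCoeff δ i (flip i t) = diagCoeff δ i t * diagCoeff δ i (flip i t) := by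
  have h0 := entry_flip_of_ne t (show i ≠ i + 1 by omega)
  have := hP (i - 2 * t.entry i)
  by_cases hp : t.entry (i + 1) = t.entry i
  · simp only [diagCoeff, flipCoeff, h0, entry_flip_peak h hp, if_pos hp,
      if_neg (Nat.succ_ne_self _), if_pos h]
    field_simp
  · simp only [diagCoeff, flipCoeff, h0, entry_flip_valley h hp, if_neg hp, if_true,
      if_pos (flippable_flip.2 h)]
    field_simp

/-- The generators have rank one on the span of a pair of tableaux. -/
theorem flipCoeff_mul_seminormal (hP : ∀ k, p δ (k + 1) ≠ 0) {i : ℕ} {t : Tableau n f}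
    (h : Flippable i t) (v : Tableau n f → K) :
    flipCoeff δ i t * seminormal δ i v (flip i t) =
      diagCoeff δ i (flip i t) * seminormal δ i v t := by
  rw [seminormal_of_turn δ h.1, seminormal_of_turn δ (turn_flip.2 h.1), flip_flip_self]
  linear_combination v t * flipCoeff_mul hP h

theorem seminormal_sq (hP : ∀ k, p δ (k + 1) ≠ 0) (i : ℕ) (v : Tableau n f → K) :
    seminormal δ i (seminormal δ i v) = δ • seminormal δ i v := by
  funext t
  rw [Pi.smul_apply, smul_eq_mul]
  by_cases ht : Turn i t
  · rw [seminormal_of_turn δ ht (seminormal δ i v)]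
    by_cases h : Flippable i t
    · rw [flipCoeff_mul_seminormal hP h]
      linear_combination seminormal δ i v t * diagCoeff_add hP h
    · obtain ⟨h1, h2⟩ := coeff_of_not_flippable (δ := δ) ht h
      rw [h1, h2]
      ring
  · simp [seminormal_of_not_turn δ ht]

theorem coeff_flip_of_far {i j : ℕ} (t : Tableau n f) (h : i + 2 ≤ j ∨ j + 2 ≤ i) :
    diagCoeff δ i (flip j t) = diagCoeff δ i t ∧ flipCoeff δ i (flip j t) = flipCoeff δ i t := by
  simp [diagCoeff, flipCoeff, flippable_flip_of_far t h,
    entry_flip_of_ne t (show i ≠ j + 1 by omega), entry_flip_of_ne t (show i + 1 ≠ j + 1 by omega)]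

theorem seminormal_comm {i j : ℕ} (h : i + 2 ≤ j ∨ j + 2 ≤ i) (v : Tableau n f → K) :
    seminormal δ i (seminormal δ j v) = seminormal δ j (seminormal δ i v) := by
  funext t
  by_cases hi : Turn i t
  · by_cases hj : Turn j t
    · rw [seminormal_of_turn δ hi, seminormal_of_turn δ hj, seminormal_of_turn δ hj,
        seminormal_of_turn δ hi, seminormal_of_turn δ ((turn_flip_of_far t h).2 hi),
        seminormal_of_turn δ ((turn_flip_of_far t h.symm).2 hj), flip_comm t h,
        (coeff_flip_of_far t h).1, (coeff_flip_of_far t h).2, (coeff_flip_of_far t h.symm).1,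
        (coeff_flip_of_far t h.symm).2]
      ring
    · rw [seminormal_of_turn δ hi, seminormal_of_not_turn δ hj, seminormal_of_not_turn δ hj,
        seminormal_of_not_turn δ (mt (turn_flip_of_far t h.symm).1 hj)]
      ring
  · by_cases hj : Turn j t
    · rw [seminormal_of_turn δ hj, seminormal_of_not_turn δ hi, seminormal_of_not_turn δ hi,
        seminormal_of_not_turn δ (mt (turn_flip_of_far t h).1 hi)]
      ring
    · rw [seminormal_of_not_turn δ hj, seminormal_of_not_turn δ hi]

/-- Turning at both positions means that three consecutive steps alternate. Exchanging two of them
leaves two equal steps at the other position. -/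
theorem not_turn_flip_of_adjacent {i j : ℕ} {t : Tableau n f} (h : i + 1 = j ∨ j + 1 = i)
    (hj : Turn j t) (hi : Flippable i t) : ¬ Turn j (flip i t) := by
  have h1 := hi.1.entry_succ
  have h2 := hi.1.2
  have h3 := hj.2
  have h5 := entry_flip_self hi
  rintro ⟨-, h4⟩
  rcases h with rfl | rfl
  · have := entry_flip_of_ne t (show i + 1 + 2 ≠ i + 1 by omega)
    omega
  · have := entry_flip_of_ne t (show j ≠ j + 1 + 1 by omega)
    rw [show j + 1 + 1 = j + 2 by ring] at *
    omega

/-- The off-diagonal term is a value of `seminormal δ j v` at a path that does not turn at `j`, and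
such values vanish. -/
theorem seminormal_seminormal_of_adjacent {i j : ℕ} {t : Tableau n f}
    (h : i + 1 = j ∨ j + 1 = i) (hj : Turn j t) (v : Tableau n f → K) :
    seminormal δ i (seminormal δ j v) t =
      (if Turn i t then diagCoeff δ i t else 0) * seminormal δ j v t := by
  by_cases hi : Turn i t
  · rw [seminormal_of_turn δ hi, if_pos hi]
    by_cases hf : Flippable i t
    · rw [seminormal_of_not_turn δ (not_turn_flip_of_adjacent h hj hf)]
      ring
    · rw [(coeff_of_not_flippable hi hf).2]
      ring
  · rw [seminormal_of_not_turn δ hi, if_neg hi, zero_mul]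

/-- One of the two turns is a peak and the other a valley, based at neighbouring heights, so the
same two values of `p` occur in reciprocal quotients. -/
theorem diagCoeff_mul_of_adjacent (hP : ∀ k, p δ (k + 1) ≠ 0) {i j : ℕ} {t : Tableau n f}
    (h : i + 1 = j ∨ j + 1 = i) (hi : Turn i t) (hj : Turn j t) :
    diagCoeff δ i t * diagCoeff δ j t = 1 := by
  wlog hij : i + 1 = j generalizing i j
  · rw [mul_comm]
    exact this h.symm hj hi (by omega)
  subst hij
  have h1 := hi.2
  have h2 := hj.2
  have h3 := hi.entry_succ
  have h4 := hj.entry_succ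
  have h5 := t.two_mul_entry_le i
  have h6 := t.two_mul_entry_le (i + 1)
  rw [show i + 1 + 1 = i + 2 by ring] at h4
  simp only [diagCoeff]
  rw [show i + 1 + 1 = i + 2 by ring]
  rcases h3 with h3 | h3
  · rw [if_pos h3, if_neg (by omega), h3]
    obtain ⟨c, hc⟩ : ∃ c, i = 2 * t.entry i + c := ⟨i - 2 * t.entry i, by omega⟩
    rw [show i - 2 * t.entry i = c by omega, show i + 1 - 2 * t.entry i = c + 1 by omega]
    have := hP c
    have := hP (c + 1)
    field_simp
  · rw [if_neg (by omega), if_pos (by omega), h3]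
    obtain ⟨c, hc⟩ : ∃ c, i = 2 * t.entry i + 1 + c := ⟨i - 2 * t.entry i - 1, by omega⟩
    rw [show i - 2 * t.entry i = c + 1 by omega,
      show i + 1 - 2 * (t.entry i + 1) = c by omega]
    have := hP c
    have := hP (c + 1)
    field_simp

/-- Exactly one of the two tableaux of a pair turns at an adjacent position. -/
theorem turn_adjacent {i j : ℕ} {t : Tableau n f} (h : i + 1 = j ∨ j + 1 = i) (hi : i + 2 ≤ n)
    (hj : Turn j t) : Turn i t ∨ Flippable j t ∧ Turn i (flip j t) := by
  have h2 := hj.2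
  have h4 := hj.entry_succ
  have h5 := t.two_mul_entry_le i
  have h7 := t.two_mul_entry_le (i + 2)
  have h6 := t.two_mul_entry_le j
  by_cases ht : Turn i t
  · exact Or.inl ht
  right
  have ht' : t.entry (i + 2) ≠ t.entry i + 1 := fun h => ht ⟨hi, h⟩
  have hf : Flippable j t := by
    refine ⟨hj, ?_⟩
    rcases h with rfl | rfl
    · have := t.entry_succ (show i < n by omega)
      rw [show i + 1 + 1 = i + 2 by ring] at *
      omega
    · have := t.entry_succ (show j + 2 < n by omega)
      rw [show j + 1 + 2 = j + 2 + 1 by ring] at *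
      omega
  refine ⟨hf, hi, ?_⟩
  have h8 := entry_flip_self hf
  rcases h with rfl | rfl
  · have := entry_flip_of_ne t (show i ≠ i + 1 + 1 by omega)
    have := t.entry_succ (show i < n by omega)
    rw [show i + 1 + 1 = i + 2 by ring] at *
    omega
  · have := entry_flip_of_ne t (show j + 1 + 2 ≠ j + 1 by omega)
    have := t.entry_succ (show j + 2 < n by omega)
    rw [show j + 1 + 2 = j + 2 + 1 by ring] at *
    omega

/-- In each pair for `j`, exactly one member survives the action at `i`, where it is multiplied by
the inverse of its diagonal coefficient for `j`. Since the block for `j` has rank one, this restores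
the original value. -/
theorem seminormal_braid (hP : ∀ k, p δ (k + 1) ≠ 0) {i j : ℕ} (h : i + 1 = j ∨ j + 1 = i)
    (hi : i + 2 ≤ n) (v : Tableau n f → K) :
    seminormal δ j (seminormal δ i (seminormal δ j v)) = seminormal δ j v := by
  funext t
  by_cases hj : Turn j t
  · rw [seminormal_of_turn δ hj, seminormal_seminormal_of_adjacent h hj,
      seminormal_seminormal_of_adjacent h (turn_flip.2 hj)]
    rcases turn_adjacent h hi hj with ht | ⟨hf, ht⟩
    · have h1 := diagCoeff_mul_of_adjacent hP h ht hj
      rw [if_pos ht]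
      by_cases hf : Flippable j t
      · rw [if_neg (not_turn_flip_of_adjacent h.symm ht hf)]
        linear_combination seminormal δ j v t * h1
      · rw [(coeff_of_not_flippable (δ := δ) hj hf).2]
        linear_combination seminormal δ j v t * h1
    · have h1 := diagCoeff_mul_of_adjacent hP h ht (turn_flip.2 hj)
      have h2 := not_turn_flip_of_adjacent h.symm ht (flippable_flip.2 hf)
      rw [flip_flip_self] at h2
      rw [if_neg h2, if_pos ht]
      linear_combination seminormal δ j v t * h1 +
        diagCoeff δ i (flip j t) * flipCoeff_mul_seminormal hP hf v
  · simp [seminormal_of_not_turn δ hj]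

end Seminormal

open Tableau

/-! ### The representation on functions on tableaux -/

section Representation

variable {S : Type*} [CommRing S] {K : Type*} [Field K] [Algebra S K] {δ : S} {n f : ℕ}

/-- The seminormal representation, a right action of the algebra. -/
noncomputable def rep (hP : ∀ k, p (algebraMap S K δ) (k + 1) ≠ 0) :
    Alg δ n →ₐ[S] (Module.End K (Tableau n f → K))ᵐᵒᵖ :=
  RingQuot.liftAlgHom S
    ⟨FreeAlgebra.lift S fun i : Fin (n - 1) =>
        MulOpposite.op (seminormal (algebraMap S K δ) (i : ℕ)), by
      intro a b h
      induction h with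
      | sq i =>
        simp only [map_mul, map_smul, FreeAlgebra.lift_ι_apply, ← MulOpposite.op_mul,
          ← MulOpposite.op_smul]
        congr 1
        refine LinearMap.ext fun v => ?_
        rw [Module.End.mul_apply, seminormal_sq hP, LinearMap.smul_apply, algebraMap_smul]
      | braid i j h =>
        simp only [map_mul, FreeAlgebra.lift_ι_apply, ← MulOpposite.op_mul]
        congr 1
        refine LinearMap.ext fun v => ?_
        rw [Module.End.mul_apply, Module.End.mul_apply,
          seminormal_braid hP (by omega) (by omega)]
      | comm i j h =>
        simp only [map_mul, FreeAlgebra.lift_ι_apply, ← MulOpposite.op_mul]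
        congr 1
        refine LinearMap.ext fun v => ?_
        rw [Module.End.mul_apply, Module.End.mul_apply, seminormal_comm (by omega)]⟩

/-- Right multiplication by an element of the algebra in the seminormal representation. -/
noncomputable def rmul (hP : ∀ k, p (algebraMap S K δ) (k + 1) ≠ 0) (a : Alg δ n) :
    (Tableau n f → K) →ₗ[K] (Tableau n f → K) := (rep hP a).unop

variable (hP : ∀ k, p (algebraMap S K δ) (k + 1) ≠ 0)

theorem rmul_mul (a b : Alg δ n) (v : Tableau n f → K) :
    rmul hP (a * b) v = rmul hP b (rmul hP a v) := by
  simp [rmul]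

@[simp] theorem rmul_one (v : Tableau n f → K) : rmul hP (1 : Alg δ n) v = v := by
  simp [rmul]

@[simp] theorem rmul_zero (v : Tableau n f → K) : rmul hP (0 : Alg δ n) v = 0 := by
  simp [rmul]

theorem rmul_add (a b : Alg δ n) (v : Tableau n f → K) :
    rmul hP (a + b) v = rmul hP a v + rmul hP b v := by
  simp [rmul]

theorem rmul_sub (a b : Alg δ n) (v : Tableau n f → K) :
    rmul hP (a - b) v = rmul hP a v - rmul hP b v := by
  simp [rmul]

theorem rmul_neg (a : Alg δ n) (v : Tableau n f → K) :
    rmul hP (-a) v = -rmul hP a v := by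
  simp [rmul]

theorem rmul_smul (r : S) (a : Alg δ n) (v : Tableau n f → K) :
    rmul hP (r • a) v = algebraMap S K r • rmul hP a v := by
  simp [rmul]

theorem rmul_sum {ι : Type*} (s : Finset ι) (a : ι → Alg δ n) (v : Tableau n f → K) :
    rmul hP (∑ i ∈ s, a i) v = ∑ i ∈ s, rmul hP (a i) v := by
  classical
  induction s using Finset.induction_on with
  | empty => simp
  | insert i s hi ih => rw [Finset.sum_insert hi, Finset.sum_insert hi, rmul_add, ih]

theorem rmul_e {i : ℕ} (h : i + 1 < n) (v : Tableau n f → K) :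
    rmul hP (e δ n (i + 1)) v = seminormal (algebraMap S K δ) i v := by
  rw [e, dif_pos (by omega), rmul, rep, RingQuot.liftAlgHom_mkAlgHom_apply]
  simp

/-! ### The tableau `𝔱^λ` -/

/-- The tableau `𝔱^λ`. -/
def baseTableau (hf : 2 * f ≤ n) : Tableau n f :=
  ofEntry (fun k => min (k / 2) f) (by simp) (by intro k _; omega) (by intro k _; omega) (by omega)

theorem entry_baseTableau (hf : 2 * f ≤ n) {k : ℕ} (hk : k ≤ n) :
    (baseTableau hf).entry k = min (k / 2) f := entry_ofEntry hk

open Classical in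
/-- The basis vector of `𝔱^λ`. -/
noncomputable def baseVector (K : Type*) [Field K] (hf : 2 * f ≤ n) : Tableau n f → K :=
  Pi.single (baseTableau hf) 1

theorem baseVector_self (hf : 2 * f ≤ n) : baseVector K hf (baseTableau hf) = 1 := by
  simp [baseVector]

theorem baseVector_of_ne (hf : 2 * f ≤ n) {t : Tableau n f} (h : t ≠ baseTableau hf) :
    baseVector K hf t = 0 := by
  simp [baseVector, h]

/-- The last factor `e_{2k+1}` forces a turn at `2k`, and its flip alters only an odd time. The
conditions imposed by earlier factors concern even times and persist. -/
theorem entry_of_rmul_m_ne_zero {k : ℕ} (hk : 2 * k ≤ n) {v : Tableau n f → K}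
    {s : Tableau n f} (h : rmul hP (m δ n k) v s ≠ 0) : ∀ i ≤ k, s.entry (2 * i) = i := by
  induction k generalizing s with
  | zero =>
    intro i hi
    obtain rfl : i = 0 := by omega
    simp
  | succ k ih =>
    rw [m_succ, rmul_mul, rmul_e hP (by omega)] at h
    have ht : Turn (2 * k) s := by
      by_contra ht
      exact h (seminormal_of_not_turn _ ht _)
    have hs : ∀ i ≤ k, s.entry (2 * i) = i := by
      rw [seminormal_of_turn _ ht] at h
      intro i hi
      by_cases h0 : rmul hP (m δ n k) v s = 0
      · have h1 : rmul hP (m δ n k) v (flip (2 * k) s) ≠ 0 := by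
          intro h1
          simp [h0, h1] at h
        have := ih (by omega) h1 i hi
        rwa [entry_flip_of_ne _ (by omega)] at this
      · exact ih (by omega) h0 i hi
    intro i hi
    rcases (show i ≤ k ∨ i = k + 1 by omega) with hi | rfl
    · exact hs i hi
    · rw [show 2 * (k + 1) = 2 * k + 2 by ring, ht.2, hs k le_rfl]

theorem rmul_m_eq_zero {k : ℕ} (hk : 2 * k ≤ n) (hfk : f < k) (v : Tableau n f → K) :
    rmul hP (m δ n k) v = 0 := by
  funext s
  by_contra h
  have h1 := entry_of_rmul_m_ne_zero hP hk h k le_rfl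
  have h2 := s.entry_mono hk le_rfl
  rw [entry_last] at h2
  omega

/-- A path that is at height zero at the times `0, 2, …, 2f`, and has no down-steps left afterwards,
is the base path. -/
theorem rmul_m_eq_smul (hf : 2 * f ≤ n) (v : Tableau n f → K) :
    rmul hP (m δ n f) v = rmul hP (m δ n f) v (baseTableau hf) • baseVector K hf := by
  funext s
  rw [Pi.smul_apply, smul_eq_mul]
  by_cases hs : s = baseTableau hf
  · rw [hs, baseVector_self, mul_one]
  · rw [baseVector_of_ne hf hs, mul_zero]
    by_contra h
    have h1 := entry_of_rmul_m_ne_zero hP hf h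
    apply hs
    apply ext_entry
    intro k hk
    rw [entry_baseTableau hf hk]
    have h2 := s.two_mul_entry_le k
    rcases le_total k (2 * f) with hkf | hkf
    · have h3 := s.entry_mono (show 2 * (k / 2) ≤ k by omega) hk
      rw [h1 _ (by omega)] at h3
      omega
    · have h3 := s.entry_mono hkf hk
      have h4 := s.entry_mono hk le_rfl
      rw [h1 _ le_rfl] at h3
      rw [entry_last] at h4
      omega

theorem rmul_eq_zero_of_mem_checkIdeal {a : Alg δ n} (ha : a ∈ checkIdeal δ n f)
    (v : Tableau n f → K) : rmul hP a v = 0 := by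
  have h : checkIdeal δ n f ≤ TwoSidedIdeal.ker (rep (n := n) (f := f) hP) := by
    refine iSup₂_le fun k hk => ?_
    rw [cellIdeal, TwoSidedIdeal.span_le, Set.singleton_subset_iff, SetLike.mem_coe,
      TwoSidedIdeal.mem_ker]
    apply MulOpposite.unop_injective
    exact LinearMap.ext fun v => rmul_m_eq_zero hP hk.2 hk.1 v
  have := (TwoSidedIdeal.mem_ker _).1 (h ha)
  simp [rmul, this]

theorem turn_baseTableau (hf : 2 * f ≤ n) {i : ℕ} (hi : i < f) :
    Turn (2 * i) (baseTableau hf) ∧ ¬ Flippable (2 * i) (baseTableau hf) := by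
  rw [Flippable, Turn, entry_baseTableau hf (by omega), entry_baseTableau hf (by omega)]
  omega

theorem seminormal_baseVector (hf : 2 * f ≤ n) {i : ℕ} (hi : i < f) (x : K) :
    seminormal x (2 * i) (baseVector K hf) = x • baseVector K hf := by
  obtain ⟨h1, h2⟩ := turn_baseTableau hf hi
  funext t
  rw [Pi.smul_apply, smul_eq_mul]
  by_cases ht : t = baseTableau hf
  · rw [ht, seminormal_of_turn _ h1, (coeff_of_not_flippable h1 h2).1,
      (coeff_of_not_flippable h1 h2).2]
    ring
  · have : flip (2 * i) t ≠ baseTableau hf := by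
      intro h
      apply ht
      rw [← flip_flip_self (2 * i) t, h, flip_of_not h2]
    by_cases hT : Turn (2 * i) t
    · rw [seminormal_of_turn _ hT, baseVector_of_ne hf ht, baseVector_of_ne hf this]
      ring
    · rw [seminormal_of_not_turn _ hT, baseVector_of_ne hf ht, mul_zero]

theorem rmul_m_baseVector (hf : 2 * f ≤ n) {k : ℕ} (hk : k ≤ f) :
    rmul hP (m δ n k) (baseVector K hf) = algebraMap S K δ ^ k • baseVector K hf := by
  induction k with
  | zero => simp
  | succ k ih =>
    rw [m_succ, rmul_mul, rmul_e hP (by omega), ih (by omega), map_smul,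
      seminormal_baseVector hf (by omega), smul_smul, pow_succ]

end Representation

/-! ### The invariant form -/

section Form

variable {K : Type*} [Field K] (x : K) {n f : ℕ}

/-- The contribution of the step from `k` to `k + 1` to the norm of a basis vector. -/
noncomputable def stepNorm (t : Tableau n f) (k : ℕ) : K :=
  if t.entry (k + 1) = t.entry k then 1
  else p x (k + 3 - 2 * t.entry (k + 1)) / p x (k + 2 - 2 * t.entry (k + 1))

/-- The norm of a basis vector of the seminormal representation. -/
noncomputable def norm (t : Tableau n f) : K := ∏ k ∈ Finset.range n, stepNorm x t k

/-- The invariant form of the seminormal representation. -/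
noncomputable def form (v w : Tableau n f → K) : K := ∑ t, norm x t * v t * w t

variable {x}

/-- The symmetry condition for the off-diagonal entries. Passing from peak to valley lowers one
down-step by one level, and the quotient of the two step norms is cancelled by the coefficient of
the valley. -/
theorem norm_flip_mul_flipCoeff (hP : ∀ k, p x (k + 1) ≠ 0) {i : ℕ} {t : Tableau n f}
    (h : Flippable i t) :
    norm x (flip i t) * flipCoeff x i (flip i t) = norm x t * flipCoeff x i t := by
  -- The identity is symmetric under `flip i`, so `t` may be taken to be the peak.
  wlog hp : t.entry (i + 1) = t.entry i generalizing t
  · have := this (t := flip i t) (flippable_flip.2 h)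
      (by rw [entry_flip_valley h hp, entry_flip_of_ne _ (by omega)])
    rw [flip_flip_self] at this
    exact this.symm
  have hn := h.1.1
  have h2 := h.1.2
  have hpk := entry_flip_peak h hp
  have hm : i ∈ Finset.range n := Finset.mem_range.2 (by omega)
  have hm' : i + 1 ∈ (Finset.range n).erase i := by simp; omega
  have hrest : ∏ k ∈ ((Finset.range n).erase i).erase (i + 1), stepNorm x (flip i t) k =
      ∏ k ∈ ((Finset.range n).erase i).erase (i + 1), stepNorm x t k := by
    refine Finset.prod_congr rfl fun k hk => ?_
    simp only [Finset.mem_erase] at hk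
    rw [stepNorm, stepNorm, entry_flip_of_ne t (by omega), entry_flip_of_ne t (by omega)]
  obtain ⟨c, hc⟩ : ∃ c, i = 2 * t.entry i + 1 + c := ⟨i - 2 * t.entry i - 1, by have := h.2; omega⟩
  have e0 := entry_flip_of_ne t (show i ≠ i + 1 by omega)
  have e2 := entry_flip_of_ne t (show i + 2 ≠ i + 1 by omega)
  rw [norm, norm, ← Finset.mul_prod_erase _ _ hm, ← Finset.mul_prod_erase _ _ hm',
    ← Finset.mul_prod_erase _ (stepNorm x t) hm, ← Finset.mul_prod_erase _ (stepNorm x t) hm',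
    hrest]
  have s1 : stepNorm x (flip i t) i = p x (c + 2) / p x (c + 1) := by
    rw [stepNorm, hpk, e0, if_neg (by omega)]
    congr 2 <;> omega
  have s2 : stepNorm x (flip i t) (i + 1) = 1 := by
    rw [stepNorm, hpk, show i + 1 + 1 = i + 2 from rfl, e2, if_pos (by omega)]
  have s3 : stepNorm x t i = 1 := by rw [stepNorm, if_pos hp]
  have s4 : stepNorm x t (i + 1) = p x (c + 3) / p x (c + 2) := by
    rw [stepNorm, hp, show i + 1 + 1 = i + 2 from rfl, h2, if_neg (by omega)]
    congr 2 <;> omega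
  have s5 : flipCoeff x i t = 1 := by rw [flipCoeff, if_pos hp, if_pos h]
  have s6 : flipCoeff x i (flip i t) = p x (c + 1) * p x (c + 3) / p x (c + 2) ^ 2 := by
    rw [flipCoeff, hpk, e0, if_neg (by omega), show i - 2 * t.entry i = c + 1 by omega]
  rw [s1, s2, s3, s4, s5, s6]
  have := hP c
  have := hP (c + 1)
  field_simp

/-- The diagonal part is visibly symmetric. The off-diagonal weights `B` are invariant under `flip
i`, and reindexing along this involution exchanges the roles of `v` and `w`. -/
theorem form_seminormal (hP : ∀ k, p x (k + 1) ≠ 0) (i : ℕ) (v w : Tableau n f → K) :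
    form x (seminormal x i v) w = form x v (seminormal x i w) := by
  let A : Tableau n f → K := fun t => if Turn i t then norm x t * diagCoeff x i t else 0
  let B : Tableau n f → K := fun t => if Turn i t then norm x t * flipCoeff x i t else 0
  have hB : ∀ t, B (flip i t) = B t := by
    intro t
    by_cases hf : Flippable i t
    · simp only [B, if_pos hf.1, if_pos (turn_flip.2 hf.1), norm_flip_mul_flipCoeff hP hf]
    · rw [flip_of_not hf]
  have h1 : form x (seminormal x i v) w =
      ∑ t, A t * v t * w t + ∑ t, B t * v (flip i t) * w t := by
    rw [form, ← Finset.sum_add_distrib]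
    refine Finset.sum_congr rfl fun t _ => ?_
    by_cases ht : Turn i t
    · simp only [A, B, if_pos ht, seminormal_of_turn x ht]
      ring
    · simp [A, B, if_neg ht, seminormal_of_not_turn x ht]
  have h2 : form x v (seminormal x i w) =
      ∑ t, A t * v t * w t + ∑ t, B t * v t * w (flip i t) := by
    rw [form, ← Finset.sum_add_distrib]
    refine Finset.sum_congr rfl fun t _ => ?_
    by_cases ht : Turn i t
    · simp only [A, B, if_pos ht, seminormal_of_turn x ht]
      ring
    · simp [A, B, if_neg ht, seminormal_of_not_turn x ht]
  have hinv : Function.Involutive (flip i : Tableau n f → Tableau n f) := flip_flip_self i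
  rw [h1, h2, ← Equiv.sum_comp hinv.toPerm fun t => B t * v t * w (flip i t)]
  congr 1
  refine Finset.sum_congr rfl fun t _ => ?_
  rw [Function.Involutive.coe_toPerm, hB, flip_flip_self]

theorem form_smul_left (r : K) (v w : Tableau n f → K) : form x (r • v) w = r * form x v w := by
  rw [form, form, Finset.mul_sum]
  refine Finset.sum_congr rfl fun t _ => ?_
  rw [Pi.smul_apply, smul_eq_mul]
  ring

theorem form_smul_right (r : K) (v w : Tableau n f → K) :
    form x v (r • w) = r * form x v w := by
  rw [form, form, Finset.mul_sum]
  refine Finset.sum_congr rfl fun t _ => ?_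
  rw [Pi.smul_apply, smul_eq_mul]
  ring

theorem form_baseVector (hf : 2 * f ≤ n) (v : Tableau n f → K) :
    form x v (baseVector K hf) = norm x (baseTableau hf) * v (baseTableau hf) := by
  rw [form, Finset.sum_eq_single (baseTableau hf)]
  · rw [baseVector_self, mul_one]
  · intro t _ ht
    rw [baseVector_of_ne hf ht, mul_zero]
  · simp

/-- Every down-step of the base path goes from height one to zero and contributes `p 2 / p 1 = x`.
-/
theorem norm_baseTableau (hf : 2 * f ≤ n) : norm x (baseTableau hf) = x ^ f := by
  have : ∀ N ≤ n, ∏ k ∈ Finset.range N, stepNorm x (baseTableau hf) k = x ^ min (N / 2) f := by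
    intro N
    induction N with
    | zero => simp
    | succ N ih =>
      intro hN
      rw [Finset.prod_range_succ, ih (by omega), stepNorm, entry_baseTableau hf hN,
        entry_baseTableau hf (by omega)]
      by_cases h : min ((N + 1) / 2) f = min (N / 2) f
      · rw [if_pos h, h, mul_one]
      · rw [if_neg h, show N + 3 - 2 * min ((N + 1) / 2) f = 2 by omega,
          show N + 2 - 2 * min ((N + 1) / 2) f = 1 by omega,
          show min ((N + 1) / 2) f = min (N / 2) f + 1 by omega, p_two, p_one, div_one, pow_succ]
  rw [norm, this n le_rfl, show min (n / 2) f = f by omega]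

end Form

/-! ### Adjoints of words, and `m_λ` as a rank-one operator -/

section Adjoint

variable {S : Type*} [CommRing S] {K : Type*} [Field K] [Algebra S K] {δ : S} {n f : ℕ}
variable (hP : ∀ k, p (algebraMap S K δ) (k + 1) ≠ 0)

theorem form_rmul_e (i : ℕ) (v u : Tableau n f → K) :
    form (algebraMap S K δ) (rmul hP (e δ n i) v) u =
      form (algebraMap S K δ) v (rmul hP (e δ n i) u) := by
  by_cases h : 1 ≤ i ∧ i < n
  · obtain ⟨i, rfl⟩ : ∃ j, i = j + 1 := ⟨i - 1, by omega⟩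
    rw [rmul_e hP h.2, rmul_e hP h.2, form_seminormal hP]
  · simp [e_eq_zero δ n h, form]

theorem form_rmul_w {i j : ℕ} (hij : i ≤ j) (v u : Tableau n f → K) :
    form (algebraMap S K δ) (rmul hP (w δ n i j) v) u =
      form (algebraMap S K δ) v (rmul hP (w δ n j i) u) := by
  induction j, hij using Nat.le_induction generalizing v u with
  | base => simp
  | succ j hj ih =>
    rw [w_succ_right δ n hj, w_succ_left_desc δ n hj, rmul_mul, rmul_mul, form_rmul_e, ih]

theorem form_rmul_vAux {a : ℕ → ℕ} {k : ℕ} (ha : ∀ l ≤ k, 2 * a l ≤ l)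
    (v u : Tableau n f → K) :
    form (algebraMap S K δ) (rmul hP (vAux δ n a k) v) u =
      form (algebraMap S K δ) v (rmul hP (vStarAux δ n a k) u) := by
  induction k generalizing v u with
  | zero => simp [vAux, vStarAux]
  | succ k ih =>
    have ih := ih fun l hl => ha l (by omega)
    rw [vAux, vStarAux]
    split_ifs
    · exact ih v u
    -- The bound `2 * a (k + 1) ≤ k + 1` makes the word ascending, so that its reversal is the word
    -- used in `vStarAux`.
    · rw [rmul_mul, rmul_mul, ih, form_rmul_w hP (ha (k + 1) le_rfl)]

theorem form_rmul_v (t : Tableau n f) (v' u : Tableau n f → K) :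
    form (algebraMap S K δ) (rmul hP (v δ t) v') u =
      form (algebraMap S K δ) v' (rmul hP (vStar δ t) u) :=
  form_rmul_vAux hP (fun l _ => t.two_mul_entry_le l) v' u

theorem form_rmul_m (hf : 2 * f ≤ n) {k : ℕ} (hk : k ≤ f) (v : Tableau n f → K) :
    form (algebraMap S K δ) (rmul hP (m δ n k) v) (baseVector K hf) =
      algebraMap S K δ ^ k * form (algebraMap S K δ) v (baseVector K hf) := by
  induction k with
  | zero => simp
  | succ k ih =>
    rw [m_succ, rmul_mul, form_rmul_e, rmul_e hP (by omega), seminormal_baseVector hf (by omega),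
      form_smul_right, ih (by omega), pow_succ]
    ring

theorem parameter_ne_zero {x : K} (hP : ∀ k, p x (k + 1) ≠ 0) : x ≠ 0 := by
  have := hP 1
  rwa [p_two] at this

/-- The action of `m_λ` is given by the form. -/
theorem rmul_m_eq_form_smul (hf : 2 * f ≤ n) (v : Tableau n f → K) :
    rmul hP (m δ n f) v = form (algebraMap S K δ) v (baseVector K hf) • baseVector K hf := by
  rw [rmul_m_eq_smul hP hf]
  congr 1
  -- Pairing with the base vector gives a factor `x ^ f` twice: as the eigenvalue of `m_λ` on the
  -- base vector, and as the norm of the base tableau. The two cancel.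
  have h := form_rmul_m hP hf le_rfl v
  rw [form_baseVector, norm_baseTableau] at h
  exact mul_left_cancel₀ (pow_ne_zero _ (parameter_ne_zero hP)) h

end Adjoint

/-! ### Triangularity -/

section Triangular

variable {K : Type*} [Field K] {n f : ℕ}

/-- The function `v` takes the value `1` at the tableau with entries `a`, and vanishes outside
of the set of the tableaux that are dominated by it. -/
def IsLeading (v : Tableau n f → K) (a : ℕ → ℕ) : Prop :=
  (∀ u, v u ≠ 0 → ∀ k ≤ n, a k ≤ u.entry k) ∧ ∀ u, (∀ k ≤ n, u.entry k = a k) → v u = 1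

theorem IsLeading.congr {v : Tableau n f → K} {a b : ℕ → ℕ} (h : IsLeading v a)
    (hab : ∀ k ≤ n, a k = b k) : IsLeading v b :=
  ⟨fun u hu k hk => hab k hk ▸ h.1 u hu k hk,
    fun u hu => h.2 u fun k hk => (hu k hk).trans (hab k hk).symm⟩

theorem isLeading_baseVector (hf : 2 * f ≤ n) :
    IsLeading (baseVector K hf) fun k => min (k / 2) f := by
  constructor
  · intro u hu k hk
    by_cases h : u = baseTableau hf
    · rw [h, entry_baseTableau hf hk]
    · exact absurd (baseVector_of_ne hf h) hu
  · intro u hu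
    rw [ext_entry (s := u) (t := baseTableau hf), baseVector_self]
    intro k hk
    rw [hu k hk, entry_baseTableau hf hk]

/-- A generator moves a valley of the leading tableau to a peak. -/
theorem IsLeading.seminormal (x : K) {v : Tableau n f → K} {a : ℕ → ℕ} (h : IsLeading v a)
    {i : ℕ} (hi : i + 2 ≤ n) (h1 : a (i + 1) = a i + 1) (h2 : a (i + 2) = a i + 1)
    (h3 : 2 * a (i + 1) ≤ i + 1) :
    IsLeading (seminormal x i v) (Function.update a (i + 1) (a i)) := by
  constructor
  · intro u hu k hk
    have ht : Turn i u := by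
      by_contra ht
      exact hu (seminormal_of_not_turn x ht v)
    have key : ∀ k ≤ n, k ≠ i + 1 → a k ≤ u.entry k := by
      intro k hk hki
      by_cases h0 : v u = 0
      · have h1 : v (flip i u) ≠ 0 := by
          intro h1
          rw [seminormal_of_turn x ht, h0, h1] at hu
          simp at hu
        have := h.1 _ h1 k hk
        rwa [entry_flip_of_ne _ hki] at this
      · exact h.1 u h0 k hk
    by_cases hki : k = i + 1
    · subst hki
      rw [Function.update_self]
      exact (key i (by omega) (by omega)).trans (u.entry_mono (by omega) hk)
    · rw [Function.update_of_ne hki]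
      exact key k hk hki
  · intro u hu
    have e0 := hu i (by omega)
    have e1 := hu (i + 1) (by omega)
    have e2 := hu (i + 2) (by omega)
    rw [Function.update_of_ne (by omega)] at e0 e2
    rw [Function.update_self] at e1
    have ht : Turn i u := ⟨hi, by omega⟩
    have hfl : Flippable i u := ⟨ht, by omega⟩
    have hp : u.entry (i + 1) = u.entry i := by omega
    -- At time `i + 1` the path `u` lies outside the support of `v`, so only the value at its flip
    -- contributes, with the peak coefficient `1`.
    have hv : v u = 0 := by
      by_contra hv
      have := h.1 u hv (i + 1) (by omega)
      omega
    have hv' : v (flip i u) = 1 := by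
      apply h.2
      intro k hk
      by_cases hki : k = i + 1
      · subst hki
        rw [entry_flip_peak hfl hp]
        omega
      · rw [entry_flip_of_ne _ hki, hu k hk, Function.update_of_ne hki]
    rw [seminormal_of_turn x ht, hv, hv', flipCoeff, if_pos hp, if_pos hfl]
    ring

variable {S : Type*} [CommRing S] [Algebra S K] {δ : S}
variable (hP : ∀ k, p (algebraMap S K δ) (k + 1) ≠ 0)

/-- The letters `e_{2b}, …, e_{j-1}` delay the `b`-th down-step of the leading path from time `2b`
to time `j`, each turning one valley into a peak. -/
theorem IsLeading.rmul_w {b k : ℕ} {a : ℕ → ℕ} (hb : 1 ≤ b) (hk : k ≤ n)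
    {j : ℕ} (hj : 2 * b ≤ j) (hjk : j ≤ k)
    {v : Tableau n f → K}
    (h : IsLeading v fun l => if l ≤ k then min (l / 2) b else a l) :
    IsLeading (rmul hP (w δ n (2 * b) j) v) fun l =>
      if l < j then min (l / 2) (b - 1) else if l ≤ k then b else a l := by
  induction j, hj using Nat.le_induction with
  | base =>
    rw [w_self, rmul_one]
    refine h.congr fun l hl => ?_
    split_ifs <;> omega
  | succ j hj ih =>
    have ih := ih (by omega)
    obtain ⟨i, rfl⟩ : ∃ i, j = i + 1 := ⟨j - 1, by omega⟩
    rw [w_succ_right δ n hj, rmul_mul, rmul_e hP (by omega)]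
    refine (ih.seminormal _ (i := i) (by omega) ?_ ?_ ?_).congr fun l hl => ?_
    · rw [if_neg (by omega), if_pos (by omega), if_pos (by omega)]; omega
    · rw [if_neg (by omega), if_pos (by omega), if_pos (by omega)]; omega
    · rw [if_neg (by omega), if_pos (by omega)]; omega
    · rcases eq_or_ne l (i + 1) with rfl | hl
      · rw [Function.update_self, if_pos (by omega), if_pos (by omega)]; omega
      · rw [Function.update_of_ne hl]
        split_ifs <;> omega

/-- In a right action the leftmost word acts first, so the last down-step is put in place first. The
intermediate leading path follows the base pattern up to time `k` and already agrees with `a`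
afterwards. -/
theorem IsLeading.rmul_vAux {a : ℕ → ℕ} (h0 : a 0 = 0) (h2 : ∀ k ≤ n, 2 * a k ≤ k)
    (hs : ∀ k < n, a (k + 1) = a k ∨ a (k + 1) = a k + 1) {k : ℕ} (hk : k ≤ n)
    {v : Tableau n f → K} (h : IsLeading v fun l => if l ≤ k then min (l / 2) (a k) else a l) :
    IsLeading (rmul hP (vAux δ n a k) v) a := by
  induction k generalizing v with
  | zero =>
    rw [vAux, rmul_one]
    refine h.congr fun l _ => ?_
    split_ifs with hl
    · obtain rfl : l = 0 := by omega
      simp [h0]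
    · rfl
  | succ k ih =>
    have h3 := h2 (k + 1) hk
    rw [vAux]
    rcases hs k hk with hs | hs
    · rw [if_pos hs]
      refine ih (by omega) (h.congr fun l _ => ?_)
      rcases (show l ≤ k ∨ l = k + 1 ∨ k + 1 < l by omega) with hl | rfl | hl
      · rw [if_pos (by omega), if_pos hl, hs]
      · rw [if_pos le_rfl, if_neg (by omega)]; omega
      · rw [if_neg (by omega), if_neg (by omega)]
    · rw [if_neg (by omega), rmul_mul]
      refine ih (by omega) ((h.rmul_w hP (by omega) hk h3 le_rfl).congr
        fun l _ => ?_)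
      rcases (show l ≤ k ∨ l = k + 1 ∨ k + 1 < l by omega) with hl | rfl | hl
      · rw [if_pos (by omega), if_pos hl, hs]; omega
      · rw [if_neg (by omega), if_pos (by omega), if_neg (by omega)]
      · rw [if_neg (by omega), if_neg (by omega), if_neg (by omega)]

/-- The image of `m_𝔱` in the seminormal representation. -/
noncomputable def murphyVector (hf : 2 * f ≤ n) (t : Tableau n f) : Tableau n f → K :=
  rmul hP (v δ t) (baseVector K hf)

theorem isLeading_murphyVector (hf : 2 * f ≤ n) (t : Tableau n f) :
    IsLeading (murphyVector hP hf t) t.entry := by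
  refine IsLeading.rmul_vAux hP t.entry_zero (fun k _ => t.two_mul_entry_le k)
    (fun k hk => Tableau.entry_succ t hk) le_rfl ((isLeading_baseVector hf).congr fun k hk => ?_)
  rw [if_pos hk, entry_last]

theorem v_baseTableau (δ : S) (hf : 2 * f ≤ n) : v δ (baseTableau hf) = 1 := by
  have : ∀ k ≤ n, vAux δ n (baseTableau hf).entry k = 1 := by
    intro k
    induction k with
    | zero => intro _; rfl
    | succ k ih =>
      intro hk
      rw [vAux, ih (by omega), mul_one, entry_baseTableau hf hk, entry_baseTableau hf (by omega)]
      split_ifs with h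
      · rfl
      · rw [show 2 * min ((k + 1) / 2) f = k + 1 by omega, w_self]
  exact this n le_rfl

theorem vStar_baseTableau (δ : S) (hf : 2 * f ≤ n) : vStar δ (baseTableau hf) = 1 := by
  have : ∀ k ≤ n, vStarAux δ n (baseTableau hf).entry k = 1 := by
    intro k
    induction k with
    | zero => intro _; rfl
    | succ k ih =>
      intro hk
      rw [vStarAux, ih (by omega), one_mul, entry_baseTableau hf hk,
        entry_baseTableau hf (by omega)]
      split_ifs with h
      · rfl
      · rw [show 2 * min ((k + 1) / 2) f = k + 1 by omega, w_self]
  exact this n le_rfl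

theorem murphyVector_baseTableau (hf : 2 * f ≤ n) :
    murphyVector hP hf (baseTableau hf) = baseVector K hf := by
  rw [murphyVector, v_baseTableau, rmul_one]

open Classical in
/-- The matrix of the vectors `murphyVector`. -/
noncomputable def murphyMatrix (hf : 2 * f ≤ n) : Matrix (Tableau n f) (Tableau n f) K :=
  Matrix.of fun t s => murphyVector hP hf t s

-- By `isLeading_murphyVector` the matrix is unitriangular for the pointwise order on entries; the
-- lexicographic order is a linear extension of it.
open Classical in
theorem det_murphyMatrix (hf : 2 * f ≤ n) : (murphyMatrix hP hf).det = 1 := by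
  let : LinearOrder (Tableau n f) :=
    LinearOrder.lift' (fun t => toLex t.1) fun s t h => Subtype.ext (toLex.injective h)
  have h : (murphyMatrix hP hf).IsUpperTriangular := by
    intro t s hst
    by_contra hne
    have h1 := (isLeading_murphyVector hP hf t).1 s hne
    have h2 : toLex t.1 ≤ toLex s.1 := by
      apply Pi.toLex_monotone
      intro k
      have := h1 k (by omega)
      rwa [entry_of_le _ (by omega), entry_of_le _ (by omega)] at this
    exact absurd hst (not_lt.2 h2)
  have h3 := Matrix.det_of_isUpperTriangular h
  convert h3
  symm
  apply Finset.prod_eq_one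
  intro t _
  exact (isLeading_murphyVector hP hf t).2 t fun _ _ => rfl

theorem linearIndependent_murphyVector (hf : 2 * f ≤ n) :
    LinearIndependent K (murphyVector (f := f) hP hf) := by
  classical
  have h := det_murphyMatrix (f := f) hP hf
  have h2 := Matrix.linearIndependent_rows_of_isUnit
    ((Matrix.isUnit_iff_isUnit_det _).2 (h ▸ isUnit_one))
  exact h2

end Triangular

section

variable {K : Type*} [Field K] {x : K} {n f : ℕ}

theorem form_comm (v w : Tableau n f → K) : form x v w = form x w v :=
  Finset.sum_congr rfl fun t _ => by ring

theorem form_add_left (v v' w : Tableau n f → K) :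
    form x (v + v') w = form x v w + form x v' w := by
  rw [form, form, form, ← Finset.sum_add_distrib]
  refine Finset.sum_congr rfl fun t _ => ?_
  rw [Pi.add_apply]
  ring

end

/-! ### The form of the cell module -/

section CellForm

variable {S : Type*} [CommRing S] {K : Type*} [Field K] [Algebra S K] {δ : S} {n f : ℕ}

theorem toQuo_surjective : Function.Surjective (toQuo δ n f) := RingCon.mk'_surjective _

theorem exists_m_mul_eq_sum (hf : 2 * f ≤ n) (a : Alg δ n) :
    ∃ c : Tableau n f → S, m δ n f * a - ∑ t, c t • (m δ n f * v δ t) ∈ checkIdeal δ n f := by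
  have h := (mem_murphySpan δ n).1 (m_mul_mem_murphySpan δ n hf a)
  obtain ⟨c, hc⟩ := (Submodule.mem_span_range_iff_exists_fun S).1 h
  refine ⟨c, (toQuo_eq_zero δ n).1 ?_⟩
  rw [map_sub, map_sum, ← hc, sub_eq_zero]
  rfl

section

variable (hP : ∀ k, p (algebraMap S K δ) (k + 1) ≠ 0)

/-- The image of `m_λ a m_λ` in the quotient is a multiple of that of `m_λ`. -/
theorem exists_m_mul_mul_m (hinj : Function.Injective (algebraMap S K)) (hf : 2 * f ≤ n)
    (a : Alg δ n) :
    ∃ c : S, m δ n f * a * m δ n f - c • m δ n f ∈ checkIdeal δ n f ∧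
      algebraMap S K c =
        form (algebraMap S K δ) (rmul hP a (baseVector K hf)) (baseVector K hf) := by
  classical
  set x := algebraMap S K δ with hx
  set r := form x (rmul hP a (baseVector K hf)) (baseVector K hf) with hr
  obtain ⟨c, hc⟩ := exists_m_mul_eq_sum hf (a * m δ n f)
  -- Applied to the base vector, the expansion of `m_λ a m_λ` must equal a multiple of the base
  -- vector, which is itself a Murphy vector. Independence of the Murphy vectors leaves only that
  -- coefficient.
  have h1 := rmul_eq_zero_of_mem_checkIdeal hP hc (baseVector K hf)
  rw [rmul_sub, rmul_mul, rmul_m_baseVector hP hf le_rfl, rmul_mul, map_smul, map_smul,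
    rmul_m_eq_form_smul hP hf, rmul_sum, sub_eq_zero] at h1
  simp only [rmul_smul, rmul_mul, rmul_m_baseVector hP hf le_rfl, map_smul] at h1
  change x ^ f • r • _ = ∑ t, algebraMap S K (c t) • x ^ f • murphyVector hP hf t at h1
  have h2 : ∑ t, (algebraMap S K (c t) - if t = baseTableau hf then r else 0) •
      murphyVector hP hf t = 0 := by
    have hxf : x ^ f ≠ 0 := pow_ne_zero _ (parameter_ne_zero hP)
    simp only [sub_smul, Finset.sum_sub_distrib, ite_smul, zero_smul, Finset.sum_ite_eq',
      Finset.mem_univ, if_true, murphyVector_baseTableau]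
    simp only [smul_comm _ (x ^ f), ← Finset.smul_sum] at h1
    rw [sub_eq_zero]
    exact (smul_right_injective _ hxf h1).symm
  have h3 := Fintype.linearIndependent_iff.1 (linearIndependent_murphyVector hP hf) _ h2
  have h4 : ∀ t, t ≠ baseTableau hf → c t = 0 := by
    intro t ht
    apply hinj
    simpa [ht] using h3 t
  refine ⟨c (baseTableau hf), ?_, by simpa [sub_eq_zero] using h3 (baseTableau hf)⟩
  rw [Finset.sum_eq_single (baseTableau hf) (fun t _ ht => by rw [h4 t ht, zero_smul]) (by simp),
    v_baseTableau, mul_one, ← mul_assoc] at hc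
  exact hc

/-- The action of the quotient by `checkIdeal` in the seminormal representation. -/
noncomputable def quoRep : Quo δ n f →+* (Module.End K (Tableau n f → K))ᵐᵒᵖ :=
  RingCon.lift _ (rep hP : Alg δ n →ₐ[S] _).toRingHom fun a b h => by
    rw [RingCon.ker_apply, ← sub_eq_zero, ← map_sub]
    apply MulOpposite.unop_injective
    exact LinearMap.ext fun v =>
      rmul_eq_zero_of_mem_checkIdeal hP ((TwoSidedIdeal.rel_iff _ _ _).1 h) v

theorem quoRep_toQuo (a : Alg δ n) (v : Tableau n f → K) :
    (quoRep hP (toQuo δ n f a)).unop v = rmul hP a v := rfl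

/-- The map of the cell module to the seminormal representation. -/
noncomputable def cellMap (hf : 2 * f ≤ n) : cellModule δ n f →ₗ[S] (Tableau n f → K) where
  -- `m_λ` multiplies the base vector by the `f`-th power of the parameter; the normalization sends
  -- the generator of the cell module to the base vector.
  toFun c := (algebraMap S K δ ^ f)⁻¹ • (quoRep hP (c : Quo δ n f)).unop (baseVector K hf)
  map_add' c d := by simp
  map_smul' r c := by
    obtain ⟨c, hc⟩ := c
    obtain ⟨a, rfl⟩ := toQuo_surjective c
    change _ • (quoRep hP (toQuo δ n f (r • a))).unop _ = _
    rw [quoRep_toQuo, rmul_smul, RingHom.id_apply, quoRep_toQuo, algebraMap_smul, smul_comm]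

theorem cellMap_act (hf : 2 * f ≤ n) (c : cellModule δ n f) (a : Alg δ n) :
    cellMap hP hf (act c a) = rmul hP a (cellMap hP hf c) := by
  simp only [cellMap, act, LinearMap.coe_mk, AddHom.coe_mk, map_mul, MulOpposite.unop_mul,
    Module.End.mul_apply, quoRep_toQuo, map_smul]

theorem cellMap_mBasis (hf : 2 * f ≤ n) (t : Tableau n f) :
    cellMap hP hf (mBasis δ t) = murphyVector hP hf t := by
  rw [mBasis, cellMap_act, murphyVector]
  congr 1
  change (algebraMap S K δ ^ f)⁻¹ • (quoRep hP (toQuo δ n f (m δ n f))).unop _ = _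
  rw [quoRep_toQuo, rmul_m_baseVector hP hf le_rfl,
    inv_smul_smul₀ (pow_ne_zero _ (parameter_ne_zero hP))]

theorem linearIndependent_mBasis (hP : ∀ k, p (algebraMap S K δ) (k + 1) ≠ 0)
    (hinj : Function.Injective (algebraMap S K)) (hf : 2 * f ≤ n) :
    LinearIndependent S (mBasis δ : Tableau n f → cellModule δ n f) := by
  apply LinearIndependent.of_comp (cellMap hP hf)
  have : cellMap hP hf ∘ mBasis δ = murphyVector hP hf := funext (cellMap_mBasis hP hf)
  rw [this]
  refine (linearIndependent_murphyVector hP hf).restrict_scalars ?_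
  intro r s h
  apply hinj
  simpa [Algebra.smul_def] using h

end

theorem span_mBasis (δ : S) (hf : 2 * f ≤ n) :
    Submodule.span S (Set.range (mBasis δ : Tableau n f → cellModule δ n f)) = ⊤ := by
  rw [eq_top_iff]
  rintro ⟨y, hy⟩ -
  obtain ⟨q, hq⟩ := id hy
  obtain ⟨a, rfl⟩ := toQuo_surjective q
  rw [LinearMap.mulLeft_apply, ← map_mul] at hq
  have h := (mem_murphySpan δ n).1 (m_mul_mem_murphySpan δ n hf a)
  obtain ⟨c, hc⟩ := (Submodule.mem_span_range_iff_exists_fun S).1 h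
  refine (Submodule.mem_span_range_iff_exists_fun S).2 ⟨c, Subtype.ext ?_⟩
  refine (Submodule.coe_sum _ _ _).trans (Eq.trans ?_ (hc.trans hq))
  refine Finset.sum_congr rfl fun t _ => ?_
  rw [Submodule.coe_smul, map_mul]
  rfl

variable (hP : ∀ k, p (algebraMap S K δ) (k + 1) ≠ 0)

/-- Since `m_{𝔲𝔰} m_{𝔱𝔴} = v_𝔲^* (m_λ v_𝔰 v_𝔱^* m_λ) v_𝔴`, the scalars of `exists_m_mul_mul_m` serve
as the Gram matrix in the basis `m_𝔱`. -/
theorem existsUnique_isCellForm (hP : ∀ k, p (algebraMap S K δ) (k + 1) ≠ 0)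
    (hinj : Function.Injective (algebraMap S K)) (hf : 2 * f ≤ n) :
    ∃! B, IsCellForm δ n f B := by
  classical
  choose c hc hc' using exists_m_mul_mul_m (f := f) hP hinj hf
  let b : Module.Basis (Tableau n f) S (cellModule δ n f) :=
    Module.Basis.mk (linearIndependent_mBasis hP hinj hf) (span_mBasis δ hf).ge
  have hb : ∀ t, b t = mBasis δ t := fun t => Module.Basis.mk_apply _ _ t
  refine ⟨Matrix.toBilin b (Matrix.of fun s t => c (v δ s * vStar δ t)), ?_, ?_⟩
  · intro s t u w
    have h1 : Matrix.toBilin b (Matrix.of fun s t => c (v δ s * vStar δ t)) (mBasis δ s)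
        (mBasis δ t) = c (v δ s * vStar δ t) := by
      rw [← hb, ← hb, ← LinearMap.BilinForm.toMatrix_apply, LinearMap.BilinForm.toMatrix_toBilin]
      rfl
    rw [h1]
    have h2 := hc (v δ s * vStar δ t)
    have h3 := TwoSidedIdeal.mul_mem_right _ _ (v δ w)
      (TwoSidedIdeal.mul_mem_left _ (vStar δ u) _ h2)
    convert h3 using 1
    simp only [murphy, mul_sub, sub_mul, mul_assoc, mul_smul_comm, smul_mul_assoc]
  · intro B hB
    refine b.ext fun s => b.ext fun t => ?_
    have h1 : Matrix.toBilin b (Matrix.of fun s t => c (v δ s * vStar δ t)) (b s) (b t) =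
        c (v δ s * vStar δ t) := by
      rw [← LinearMap.BilinForm.toMatrix_apply, LinearMap.BilinForm.toMatrix_toBilin]
      rfl
    rw [h1, hb, hb]
    -- Taking both outer tableaux equal to `𝔱^λ` isolates a multiple of `m_λ`. As `m_λ` acts on the
    -- base vector by a nonzero scalar, this multiple is determined.
    have h2 := hB s t (baseTableau hf) (baseTableau hf)
    simp only [murphy, v_baseTableau, vStar_baseTableau, one_mul, mul_one] at h2
    have h3 := sub_mem (hc (v δ s * vStar δ t)) h2
    have h4 := congrFun (rmul_eq_zero_of_mem_checkIdeal hP h3 (baseVector K hf)) (baseTableau hf)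
    simp only [rmul_sub, rmul_smul, rmul_mul, rmul_m_baseVector hP hf le_rfl, Pi.sub_apply,
      Pi.smul_apply, baseVector_self, smul_eq_mul, mul_one, Pi.zero_apply] at h4
    apply hinj
    apply mul_right_cancel₀ (pow_ne_zero f (parameter_ne_zero hP))
    linear_combination h4

theorem isCellForm_cellForm (hP : ∀ k, p (algebraMap S K δ) (k + 1) ≠ 0)
    (hinj : Function.Injective (algebraMap S K)) (hf : 2 * f ≤ n) :
    IsCellForm δ n f (cellForm δ n f) := by
  have h := existsUnique_isCellForm hP hinj hf
  rw [cellForm, dif_pos h]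
  exact h.choose_spec.1

theorem algebraMap_cellForm_mBasis (hinj : Function.Injective (algebraMap S K)) (hf : 2 * f ≤ n)
    (s t : Tableau n f) :
    algebraMap S K (cellForm δ n f (mBasis δ s) (mBasis δ t)) =
      form (algebraMap S K δ) (murphyVector hP hf s) (murphyVector hP hf t) := by
  have h := isCellForm_cellForm hP hinj hf s t (baseTableau hf) (baseTableau hf)
  simp only [murphy, v_baseTableau, vStar_baseTableau, one_mul, mul_one] at h
  have h4 := congrFun (rmul_eq_zero_of_mem_checkIdeal hP h (baseVector K hf)) (baseTableau hf)
  simp only [rmul_sub, rmul_smul, rmul_mul, rmul_m_baseVector hP hf le_rfl, map_smul] at h4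
  rw [rmul_m_eq_form_smul hP hf, Pi.sub_apply] at h4
  simp only [Pi.smul_apply, baseVector_self, smul_eq_mul, mul_one, Pi.zero_apply] at h4
  have hxf : algebraMap S K δ ^ f ≠ 0 := pow_ne_zero _ (parameter_ne_zero hP)
  rw [murphyVector, murphyVector, form_comm, form_rmul_v, form_comm]
  apply mul_left_cancel₀ hxf
  linear_combination -h4

theorem algebraMap_cellForm (hinj : Function.Injective (algebraMap S K)) (hf : 2 * f ≤ n)
    (c d : cellModule δ n f) :
    algebraMap S K (cellForm δ n f c d) =
      form (algebraMap S K δ) (cellMap hP hf c) (cellMap hP hf d) := by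
  have hc : c ∈ Submodule.span S (Set.range (mBasis δ : Tableau n f → cellModule δ n f)) := by
    rw [span_mBasis δ hf]; trivial
  have hd : d ∈ Submodule.span S (Set.range (mBasis δ : Tableau n f → cellModule δ n f)) := by
    rw [span_mBasis δ hf]; trivial
  induction hc using Submodule.span_induction with
  | zero => simp [form]
  | add a b _ _ ha hb =>
    rw [map_add, LinearMap.add_apply, map_add, map_add, form_add_left, ha, hb]
  | smul r a _ ha =>
    rw [map_smul, LinearMap.smul_apply, smul_eq_mul, map_mul, map_smul, ← algebraMap_smul K r,
      form_smul_left, ha]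
  | mem a ha =>
    obtain ⟨s, rfl⟩ := ha
    induction hd using Submodule.span_induction with
    | zero => simp [form]
    | add a b _ _ ha hb =>
      rw [map_add, map_add, map_add, form_comm, form_add_left, ha, hb, form_comm,
        form_comm _ (cellMap hP hf b)]
    | smul r a _ ha =>
      rw [map_smul, smul_eq_mul, map_mul, map_smul, ← algebraMap_smul K r, form_smul_right, ha]
    | mem a ha =>
      obtain ⟨t, rfl⟩ := ha
      rw [cellMap_mBasis, cellMap_mBasis, algebraMap_cellForm_mBasis hP hinj hf]

/-- In the coordinates of the model the Gram matrix is `U D Uᵀ`, with `U` of determinant one and `D`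
the diagonal matrix of norms. -/
theorem algebraMap_gramDet (hP : ∀ k, p (algebraMap S K δ) (k + 1) ≠ 0)
    (hinj : Function.Injective (algebraMap S K)) (hf : 2 * f ≤ n) :
    algebraMap S K (gramDet δ n f) = ∏ t : Tableau n f, norm (algebraMap S K δ) t := by
  classical
  have h : (algebraMap S K).mapMatrix (Matrix.of fun s t : Tableau n f =>
      cellForm δ n f (mBasis δ s) (mBasis δ t)) =
      murphyMatrix hP hf * Matrix.diagonal (norm (algebraMap S K δ)) *
        (murphyMatrix hP hf).transpose := by
    ext s t
    rw [RingHom.mapMatrix_apply, Matrix.map_apply, Matrix.of_apply,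
      algebraMap_cellForm_mBasis hP hinj hf, Matrix.mul_apply, form]
    refine Finset.sum_congr rfl fun u _ => ?_
    rw [Matrix.mul_diagonal, Matrix.transpose_apply]
    simp only [murphyMatrix, Matrix.of_apply]
    ring
  have hdet := det_murphyMatrix (f := f) hP hf
  have h2 : algebraMap S K (Matrix.det (Matrix.of fun s t : Tableau n f =>
      cellForm δ n f (mBasis δ s) (mBasis δ t))) =
      ∏ t : Tableau n f, norm (algebraMap S K δ) t := by
    rw [RingHom.map_det, h, Matrix.det_mul, Matrix.det_mul, Matrix.det_transpose,
      Matrix.det_diagonal, hdet, one_mul, mul_one]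
  rw [← h2, gramDet]

end CellForm

/-! ### Eigenvalues of the Jucys--Murphy elements -/

section Content

variable {K : Type*} [Field K] {x : K} {n f : ℕ}

/-- The eigenvalue of the central element `z_k` on the basis vector of a tableau. -/
def centralContent (x : K) (t : Tableau n f) (k : ℕ) : K :=
  p x (t.entry k) * p x (k + 1 - t.entry k)

/-- Both cases in the definition of `r_𝔱` are the same difference, matching `T_{k+1} = z_{k+1} - x
z_k`. The sums defining `z_j` therefore telescope. -/
theorem content_succ (t : Tableau n f) {k : ℕ} (hk : k < n) :
    content x t (k + 1) = centralContent x t (k + 1) - x * centralContent x t k := by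
  have h1 := t.two_mul_entry_le k
  have h2 := t.two_mul_entry_le (k + 1)
  rcases Nat.eq_zero_or_pos k with rfl | hk0
  · have h3 : t.entry (0 + 1) = 0 := by omega
    simp only [content, centralContent, h3, entry_zero]
    simp
  · rw [content, if_neg (by omega), Nat.add_sub_cancel, centralContent, centralContent]
    rcases Tableau.entry_succ t hk with h | h
    · rw [if_neg (by omega), h, show k + 1 + 1 - t.entry k = k + 1 - t.entry k + 1 by omega]
      ring
    · rw [if_pos h, h, show k + 1 + 1 - (t.entry k + 1) = k + 1 - t.entry k by omega,
        show k + 1 - (t.entry k + 1) + 1 = k + 1 - t.entry k by omega, Nat.add_sub_cancel]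
      ring

theorem sum_content (t : Tableau n f) {j : ℕ} (hj : j ≤ n) :
    ∑ k : Fin (j + 1), x ^ (k : ℕ) * content x t (j - k) = centralContent x t j := by
  induction j with
  | zero => simp [content, centralContent]
  | succ j ih =>
    rw [Fin.sum_univ_succ]
    simp only [Fin.val_zero, pow_zero, one_mul, Nat.sub_zero, Fin.val_succ, Nat.add_sub_add_right]
    rw [content_succ t hj, ← ih (by omega), Finset.mul_sum, sub_add_eq_add_sub, add_sub_assoc,
      ← Finset.sum_sub_distrib, Finset.sum_eq_zero, add_zero]
    intro k _
    ring

/-- Along two equal steps one of the two factors `p` stays constant and the other runs through three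
consecutive terms of the recursion. -/
theorem centralContent_straight {i : ℕ} {t : Tableau n f} (hi : i + 2 ≤ n) (h : ¬ Turn i t) :
    centralContent x t (i + 2) - x * centralContent x t (i + 1) + centralContent x t i = 0 := by
  have h0 := t.two_mul_entry_le i
  have h1 := Tableau.entry_succ t (show i < n by omega)
  have h2 := Tableau.entry_succ t (show i + 1 < n by omega)
  rw [show i + 1 + 1 = i + 2 from rfl] at h2
  have h3 : t.entry (i + 2) ≠ t.entry i + 1 := fun h' => h ⟨hi, h'⟩
  simp only [centralContent]
  rcases h1 with h1 | h1
  · rw [show t.entry (i + 2) = t.entry i by omega, h1,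
      show i + 2 + 1 - t.entry i = i + 1 - t.entry i + 2 by omega,
      show i + 1 + 1 - t.entry i = i + 1 - t.entry i + 1 by omega, p_add_two]
    ring
  · rw [show t.entry (i + 2) = t.entry i + 2 by omega, h1,
      show i + 2 + 1 - (t.entry i + 2) = i + 1 - t.entry i by omega,
      show i + 1 + 1 - (t.entry i + 1) = i + 1 - t.entry i by omega, p_add_two]
    ring

/-- One use of the recursion for `p` turns the left side into the Casoratian of `p_mul_sub`. -/
theorem centralContent_peak {i : ℕ} {t : Tableau n f} (h : Turn i t)
    (hp : t.entry (i + 1) = t.entry i) :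
    centralContent x t i + centralContent x t (i + 2) - x * centralContent x t (i + 1) =
      p x (i - 2 * t.entry i + 2) := by
  have h0 := t.two_mul_entry_le i
  rw [← p_mul_sub x (t.entry i) (i - 2 * t.entry i + 2)]
  simp only [centralContent, h.2, hp]
  rw [show i + 2 + 1 - (t.entry i + 1) = i - t.entry i + 2 by omega,
    show i + 1 + 1 - t.entry i = i - t.entry i + 2 by omega,
    show i + 1 - t.entry i = i - t.entry i + 1 by omega,
    show t.entry i + (i - 2 * t.entry i + 2) = i - t.entry i + 2 by omega,
    show i - t.entry i + 2 + 1 = i - t.entry i + 1 + 2 by omega, p_add_two x (i - t.entry i + 1)]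
  ring

theorem centralContent_valley {i : ℕ} {t : Tableau n f} (h : Turn i t)
    (hp : t.entry (i + 1) ≠ t.entry i) :
    centralContent x t i + centralContent x t (i + 2) - x * centralContent x t (i + 1) =
      -p x (i - 2 * t.entry i) := by
  have h0 := t.two_mul_entry_le i
  have h1 := h.entry_succ
  have h2 := t.two_mul_entry_le (i + 1)
  rw [← p_mul_sub x (t.entry i + 1) (i - 2 * t.entry i)]
  simp only [centralContent, h.2, show t.entry (i + 1) = t.entry i + 1 by omega]
  rw [show i + 2 + 1 - (t.entry i + 1) = i - t.entry i + 2 by omega,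
    show i + 1 + 1 - (t.entry i + 1) = i - t.entry i + 1 by omega,
    show i + 1 - t.entry i = i - t.entry i + 1 by omega,
    show t.entry i + 1 + (i - 2 * t.entry i) = i - t.entry i + 1 by omega,
    show t.entry i + 1 + 1 = t.entry i + 2 by omega, p_add_two x (t.entry i)]
  ring

theorem centralContent_flip_of_ne {i k : ℕ} (t : Tableau n f) (hk : k ≠ i + 1) :
    centralContent x (flip i t) k = centralContent x t k := by
  rw [centralContent, centralContent, entry_flip_of_ne t hk]

theorem centralContent_peak_sub_flip {i : ℕ} {t : Tableau n f} (h : Flippable i t)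
    (hp : t.entry (i + 1) = t.entry i) :
    centralContent x t (i + 1) - centralContent x (flip i t) (i + 1) =
      -p x (i - 2 * t.entry i + 1) := by
  have h0 := t.two_mul_entry_le i
  rw [← p_mul_sub x (t.entry i) (i - 2 * t.entry i + 1)]
  simp only [centralContent, hp, entry_flip_peak h hp]
  rw [show i + 1 + 1 - (t.entry i + 1) = i - t.entry i + 1 by omega,
    show i + 1 + 1 - t.entry i = i - t.entry i + 1 + 1 by omega,
    show t.entry i + (i - 2 * t.entry i + 1) = i - t.entry i + 1 by omega]
  ring

theorem centralContent_valley_sub_flip {i : ℕ} {t : Tableau n f} (h : Flippable i t)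
    (hp : t.entry (i + 1) ≠ t.entry i) :
    centralContent x t (i + 1) - centralContent x (flip i t) (i + 1) =
      p x (i - 2 * t.entry i + 1) := by
  have h1 := centralContent_peak_sub_flip (x := x) (flippable_flip.2 h)
    (by rw [entry_flip_valley h hp, entry_flip_of_ne t (by omega)])
  rw [flip_flip_self, entry_flip_of_ne t (by omega)] at h1
  linear_combination -h1

/-- The identity that makes the recursion for `T_{i+2}` diagonal. Flipping changes the content by
plus or minus the denominator of `diagCoeff`, which leaves `centralContent_peak` or
`centralContent_valley`. -/
theorem diagCoeff_mul_content_sub (hP : ∀ k, p x (k + 1) ≠ 0) {i : ℕ} {t : Tableau n f}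
    (h : Flippable i t) :
    diagCoeff x i t * (content x t (i + 1) - content x (flip i t) (i + 1)) +
      centralContent x t i + content x t (i + 2) = 0 := by
  have hn := h.1.1
  rw [content_succ t (by omega), content_succ _ (by omega),
    content_succ t (show i + 1 < n by omega), centralContent_flip_of_ne t (show i ≠ i + 1 by omega)]
  have := hP (i - 2 * t.entry i)
  by_cases hp : t.entry (i + 1) = t.entry i
  · have h1 := centralContent_peak (x := x) h.1 hp
    have h2 := centralContent_peak_sub_flip (x := x) h hp
    rw [show i + 1 + 1 = i + 2 from rfl, sub_sub_sub_cancel_right, h2, diagCoeff, if_pos hp]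
    field_simp
    linear_combination h1
  · have h1 := centralContent_valley (x := x) h.1 hp
    have h2 := centralContent_valley_sub_flip (x := x) h hp
    rw [show i + 1 + 1 = i + 2 from rfl, sub_sub_sub_cancel_right, h2, diagCoeff, if_neg hp]
    field_simp
    linear_combination h1

/-- After the flip the path is straight at `i`, so `centralContent_straight` applies. -/
theorem content_of_turn_adjacent {i : ℕ} {t : Tableau n f} (hi : Turn i t)
    (h : Flippable (i + 1) t) :
    content x (flip (i + 1) t) (i + 2) = -centralContent x t i := by
  have hn := h.1.1
  have h1 := centralContent_straight (x := x) hi.1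
    (not_turn_flip_of_adjacent (Or.inr rfl) hi h)
  rw [content_succ _ (show i + 1 < n by omega)]
  rw [centralContent_flip_of_ne t (show i ≠ i + 1 + 1 by omega)] at h1
  linear_combination h1

/-- The path is at height zero at time `i + 1`, so it arrived there by a down-step from height one.
All terms are then explicit, and a Casoratian equal to `p 1` produces the constant `-1`. -/
theorem content_of_not_flippable {i : ℕ} {t : Tableau n f} (hj : Turn (i + 1) t)
    (h : ¬ Flippable (i + 1) t) :
    x * (content x t (i + 2) + centralContent x t i) + centralContent x t (i + 1) +
      content x t (i + 3) = 0 := by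
  obtain ⟨h1, h2⟩ := not_flippable hj h
  have hn := hj.1
  have h3 := t.two_mul_entry_le i
  have h4 := Tableau.entry_succ t (show i < n by omega)
  have h5 := centralContent_peak (x := x) hj h2
  obtain ⟨a, ha⟩ : ∃ a, t.entry i = a := ⟨_, rfl⟩
  have ha' : t.entry (i + 1) = a + 1 := by omega
  have h6 : content x t (i + 2) + centralContent x t i = -1 := by
    rw [content_succ _ (show i + 1 < n by omega)]
    have h7 := p_mul_sub x a 1
    simp only [centralContent, show i + 1 + 1 = i + 2 from rfl] at h2 ⊢
    rw [h2, ha', ha, show i + 2 + 1 - (a + 1) = a + 1 + 2 by omega,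
      show i + 2 - (a + 1) = a + 1 + 1 by omega, show i + 1 - a = a + 1 + 1 by omega, p_add_two]
    rw [p_one] at h7
    linear_combination -h7
  rw [h6, content_succ _ (show i + 2 < n by omega)]
  rw [show i + 1 - 2 * t.entry (i + 1) + 2 = 2 by omega, p_two] at h5
  linear_combination h5

end Content

/-! ### Diagonal action of the Jucys--Murphy elements -/

section JucysMurphy

variable {S : Type*} [CommRing S] {K : Type*} [Field K] [Algebra S K] {δ : S} {n f : ℕ}
variable (hP : ∀ k, p (algebraMap S K δ) (k + 1) ≠ 0)

theorem rmul_sum_jm {j N : ℕ} (hj : j ≤ n) (hjN : j < N)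
    (ih : ∀ k < N, k ≤ n → ∀ (v : Tableau n f → K) t,
      rmul hP (jm δ n k) v t = content (algebraMap S K δ) t k * v t)
    (v : Tableau n f → K) (t : Tableau n f) :
    rmul hP (∑ k : Fin (j + 1), δ ^ (k : ℕ) • jm δ n (j - k)) v t =
      centralContent (algebraMap S K δ) t j * v t := by
  rw [rmul_sum, Finset.sum_apply, ← sum_content t hj, Finset.sum_mul]
  refine Finset.sum_congr rfl fun k _ => ?_
  rw [rmul_smul, Pi.smul_apply, ih _ (by omega) (by omega), map_pow, smul_eq_mul]
  ring

/-- The Jucys--Murphy elements act diagonally in the seminormal representation. -/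
theorem rmul_jm {k : ℕ} (hk : k ≤ n) (v : Tableau n f → K) (t : Tableau n f) :
    rmul hP (jm δ n k) v t = content (algebraMap S K δ) t k * v t := by
  induction k using Nat.strong_induction_on generalizing v t with
  | _ k ih =>
  match k with
  | 0 => simp [jm, content]
  | 1 => simp [jm, content]
  | 2 =>
    rw [jm, rmul_e hP (by omega)]
    have h1 := t.two_mul_entry_le 1
    have h2 := t.two_mul_entry_le 2
    by_cases ht : Turn 0 t
    · have h3 : t.entry 2 = 1 := by simpa using ht.2
      have hf : ¬ Flippable 0 t := by rintro ⟨-, h⟩; omega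
      rw [seminormal_of_turn _ ht, (coeff_of_not_flippable ht hf).1,
        (coeff_of_not_flippable ht hf).2, zero_mul, add_zero, content, if_neg (by omega), if_pos,
        h3]
      · simp [p_two]
      · simp only [h3, show 2 - 1 = 1 from rfl]; omega
    · have h3 : t.entry 2 ≠ t.entry 0 + 1 := fun h => ht ⟨by omega, h⟩
      have h4 : t.entry 2 = 0 := by rw [entry_zero] at h3; omega
      rw [seminormal_of_not_turn _ ht, content, if_neg (by omega), if_neg, h4]
      · simp
      · rw [h4]; omega
  | i + 3 =>
    set x := algebraMap S K δ with hx
    have hT : ∀ (v : Tableau n f → K) t,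
        rmul hP (jm δ n (i + 2)) v t = content x t (i + 2) * v t :=
      fun v t => ih (i + 2) (by omega) (by omega) v t
    rw [jm]
    simp only [rmul_sub, rmul_add, rmul_neg, rmul_mul, Pi.sub_apply, Pi.add_apply, Pi.neg_apply]
    rw [rmul_sum_jm hP (j := i + 1) (N := i + 3) (by omega) (by omega) ih,
      rmul_sum_jm hP (j := i) (N := i + 3) (by omega) (by omega) ih]
    simp only [rmul_e hP (show i + 1 + 1 < n by omega), rmul_e hP (show i + 1 < n by omega), hT,
      ← hx]
    by_cases hj : Turn (i + 1) t
    · have e1 : ∀ u : Tableau n f, Turn (i + 1) u →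
          rmul hP (jm δ n (i + 2)) (seminormal x i (seminormal x (i + 1) v)) u =
          content x u (i + 2) * ((if Turn i u then diagCoeff x i u else 0) *
            seminormal x (i + 1) v u) := by
        intro u hu
        rw [hT, seminormal_seminormal_of_adjacent (Or.inl rfl) hu]
      have e2 := seminormal_of_turn x hj v
      rw [seminormal_of_turn x hj (rmul hP (jm δ n (i + 2)) v),
        seminormal_of_turn x hj (rmul hP (jm δ n (i + 2)) _), e1 t hj, e1 _ (turn_flip.2 hj), hT,
        hT]
      by_cases hf : Flippable (i + 1) t
      · have h1 := diagCoeff_mul_content_sub hP hf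
        rw [show i + 1 + 1 = i + 2 from rfl, show i + 1 + 2 = i + 3 from rfl] at h1
        -- The term `e_{i+2} e_{i+1} T_{i+2} e_{i+2}` only sees the member of the pair that turns at
        -- `i`. Its contribution cancels the off-diagonal parts of the remaining terms.
        rcases turn_adjacent (i := i) (Or.inl rfl) (by omega) hj with ht | ⟨-, ht⟩
        · have h2 := content_of_turn_adjacent (x := x) ht hf
          have h3 := diagCoeff_mul_of_adjacent hP (Or.inl rfl) ht hj
          rw [if_pos ht, if_neg (not_turn_flip_of_adjacent (Or.inr rfl) ht hf)]
          rw [e2]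
          linear_combination (content x t (i + 2)) * (diagCoeff x (i + 1) t * v t +
            flipCoeff x (i + 1) t * v (flip (i + 1) t)) * h3 - v t * h1 -
            (flipCoeff x (i + 1) t * v (flip (i + 1) t) + diagCoeff x (i + 1) t * v t) * h2
        · have h2 := content_of_turn_adjacent (x := x) ht (flippable_flip.2 hf)
          have h3 := diagCoeff_mul_of_adjacent hP (Or.inl rfl) ht (turn_flip.2 hj)
          have h4 := not_turn_flip_of_adjacent (Or.inr rfl) ht (flippable_flip.2 hf)
          have h5 := flipCoeff_mul_seminormal hP hf v
          rw [flip_flip_self] at h2 h4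
          rw [centralContent_flip_of_ne t (by omega)] at h2
          rw [if_neg h4, if_pos ht]
          linear_combination content x (flip (i + 1) t) (i + 2) *
            (diagCoeff x i (flip (i + 1) t) * h5 + seminormal x (i + 1) v t * h3 + e2) -
            seminormal x (i + 1) v t * h2 - v t * h1
      · have h1 := content_of_not_flippable (x := x) hj hf
        obtain ⟨h2, h3⟩ := coeff_of_not_flippable (δ := x) hj hf
        rcases turn_adjacent (i := i) (Or.inl rfl) (by omega) hj with ht | ⟨h, -⟩
        · have h4 := diagCoeff_mul_of_adjacent hP (Or.inl rfl) ht hj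
          rw [if_pos ht, e2, h3]
          rw [h2] at h4
          rw [h2]
          linear_combination content x t (i + 2) * x * v t * h4 - v t * h1
        · exact absurd h hf
    -- Every term with a factor `e_{i+2}` vanishes here, and `-z_{i+1}` alone gives the eigenvalue.
    · have h1 := centralContent_straight (x := x) (show i + 1 + 2 ≤ n by omega) hj
      rw [seminormal_of_not_turn x hj, seminormal_of_not_turn x hj, seminormal_of_not_turn x hj,
        content_succ t (show i + 2 < n by omega)]
      linear_combination -v t * h1

end JucysMurphy

/-! ### The orthogonal basis -/

section Projection

variable {K : Type*} [Field K] {δ : K} {n f : ℕ}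

theorem content_mem_contents (s : Tableau n f) {k : ℕ} (hk : k ≤ n) :
    content δ s k ∈ contents δ k := by
  classical
  have h := s.two_mul_entry_le k
  refine Finset.mem_biUnion.2 ⟨s.entry k, Finset.mem_range.2 (by omega), ?_⟩
  refine Finset.mem_image.2 ⟨ofEntry s.entry s.entry_zero (fun l _ => s.two_mul_entry_le l)
    (fun l hl => Tableau.entry_succ s (by omega)) rfl, Finset.mem_univ _, ?_⟩
  simp only [content, entry_ofEntry (le_refl k), entry_ofEntry (Nat.sub_le k 1)]

/-- The two values differ by `p (k - 2 * s.entry k)`, by `p_mul_sub`; the index is positive because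
`t` has a larger entry at `k`. -/
theorem centralContent_ne (hP : ∀ k, p δ (k + 1) ≠ 0) {s t : Tableau n f} {k : ℕ}
    (hs : t.entry k = s.entry k + 1) : centralContent δ s k ≠ centralContent δ t k := by
  have h := t.two_mul_entry_le k
  have h1 := p_mul_sub δ (s.entry k) (k - 2 * s.entry k)
  have h2 := hP (k - 2 * s.entry k - 1)
  rw [show k - 2 * s.entry k - 1 + 1 = k - 2 * s.entry k by omega, ← h1] at h2
  intro h3
  apply h2
  simp only [centralContent, hs] at h3
  rw [show k + 1 - s.entry k = k - s.entry k + 1 by omega,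
    show k + 1 - (s.entry k + 1) = k - s.entry k by omega] at h3
  rw [show s.entry k + (k - 2 * s.entry k) = k - s.entry k by omega, h3, sub_self]

/-- Different tableaux are separated by their contents. -/
theorem exists_content_ne (hP : ∀ k, p δ (k + 1) ≠ 0) {s t : Tableau n f} (h : s ≠ t) :
    ∃ k, 2 ≤ k ∧ k ≤ n ∧ content δ s k ≠ content δ t k := by
  classical
  have hex : ∃ k, k ≤ n ∧ s.entry k ≠ t.entry k := by
    by_contra hcon
    push Not at hcon
    exact h (ext_entry hcon)
  -- At the first time where the entries differ, the preceding central contents agree, so the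
  -- contents differ exactly when the current central contents do.
  obtain ⟨hk, hne⟩ := Nat.find_spec hex
  have hmin := fun l hl => Nat.find_min hex (m := l) hl
  generalize Nat.find hex = k at hk hne hmin
  match k with
  | 0 => simp at hne
  | 1 =>
    have := s.two_mul_entry_le 1
    have := t.two_mul_entry_le 1
    omega
  | k + 2 =>
    refine ⟨k + 2, by omega, hk, ?_⟩
    have he : s.entry (k + 1) = t.entry (k + 1) := by
      by_contra h
      exact hmin (k + 1) (by omega) ⟨by omega, h⟩
    rw [content_succ s hk, content_succ t hk, centralContent, centralContent, he,
      ← centralContent, ← centralContent, Ne, sub_left_inj]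
    rw [show k + 2 = k + 1 + 1 from rfl] at hne
    have h1 := Tableau.entry_succ s hk
    have h2 := Tableau.entry_succ t hk
    rcases (show t.entry (k + 1 + 1) = s.entry (k + 1 + 1) + 1 ∨
      s.entry (k + 1 + 1) = t.entry (k + 1 + 1) + 1 by omega) with h3 | h3
    · exact centralContent_ne hP h3
    · exact (centralContent_ne hP h3).symm

variable (hP : ∀ k, p (algebraMap K K δ) (k + 1) ≠ 0)

theorem rmul_aeval {a : Alg δ n} {c : Tableau n f → K}
    (ha : ∀ v t, rmul hP a v t = c t * v t) (q : K[X]) (v : Tableau n f → K) (t : Tableau n f) :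
    rmul hP (aeval a q) v t = q.eval (c t) * v t := by
  induction q using Polynomial.induction_on generalizing v t with
  | C r =>
    rw [aeval_C, Algebra.algebraMap_eq_smul_one, rmul_smul, rmul_one, eval_C]
    rfl
  | add p q hp hq => rw [map_add, rmul_add, Pi.add_apply, hp, hq, eval_add, add_mul]
  | monomial k r h =>
    rw [pow_succ, ← mul_assoc, map_mul, rmul_mul, aeval_X, ha, h, eval_mul (q := X), eval_X]
    ring

theorem rmul_list_prod {ι : Type*} {a : ι → Alg δ n} {c : ι → Tableau n f → K} {l : List ι}
    (ha : ∀ i ∈ l, ∀ v t, rmul hP (a i) v t = c i t * v t) (v : Tableau n f → K)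
    (t : Tableau n f) :
    rmul hP (l.map a).prod v t = (l.map fun i => c i t).prod * v t := by
  induction l generalizing v with
  | nil => simp
  | cons i l ih =>
    rw [List.map_cons, List.prod_cons, rmul_mul, ih fun j hj => ha j (List.mem_cons_of_mem _ hj),
      ha i List.mem_cons_self, List.map_cons, List.prod_cons]
    ring

open Classical in
/-- The element `F_𝔱` acts as the projection to the basis vector of `𝔱`. -/
theorem rmul_bigF (t : Tableau n f) (v : Tableau n f → K) (s : Tableau n f) :
    rmul hP (bigF δ t) v s = if s = t then v s else 0 := by
  rw [bigF, rmul_list_prod hP (c := fun k s =>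
    (∏ r ∈ (contents δ k).erase (content δ t k),
      Polynomial.C (content δ t k - r)⁻¹ * (X - Polynomial.C r)).eval (content δ s k))]
  · simp only [eval_prod, eval_mul, eval_C, eval_sub, eval_X]
    split_ifs with h
    · subst h
      rw [List.prod_eq_one, one_mul]
      intro y hy
      obtain ⟨k, -, rfl⟩ := List.mem_map.1 hy
      refine Finset.prod_eq_one fun r hr => ?_
      exact inv_mul_cancel₀ (sub_ne_zero.2 (Finset.ne_of_mem_erase hr).symm)
    -- At a time `k` separating `s` from `t`, the content of `s` is one of the roots `r` in the
    -- factor for `k`.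
    · obtain ⟨k, hk2, hkn, hne⟩ := exists_content_ne hP h
      rw [List.prod_eq_zero, zero_mul]
      refine List.mem_map.2 ⟨k, by rw [List.mem_range'_1]; omega, ?_⟩
      exact Finset.prod_eq_zero (Finset.mem_erase.2 ⟨hne, content_mem_contents s hkn⟩) (by simp)
  · intro k hk v s
    rw [List.mem_range'_1] at hk
    exact rmul_aeval hP (fun v t => rmul_jm hP (by omega) v t) _ v s

end Projection

/-- The Murphy vector of `t` has value `1` at `t`, so its projection by `F_𝔱` is the basis vector of
`t`, with norm `norm δ t`. -/
theorem det_eq_prod_norm {K : Type*} [Field K] {δ : K} {n f : ℕ}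
    (hP : ∀ k, p δ (k + 1) ≠ 0) (hf : 2 * f ≤ n) :
    det δ n f = ∏ t : Tableau n f, norm δ t := by
  classical
  have hP' : ∀ k, p (algebraMap K K δ) (k + 1) ≠ 0 := hP
  refine Finset.prod_congr rfl fun t _ => ?_
  refine (algebraMap_cellForm hP' (algebraMap K K).injective hf (fBasis δ t)
    (fBasis δ t)).trans ?_
  rw [fBasis, cellMap_act, cellMap_mBasis, form, Finset.sum_eq_single t]
  · rw [rmul_bigF, if_pos rfl, (isLeading_murphyVector hP' hf t).2 t fun _ _ => rfl, mul_one,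
      mul_one]
    rfl
  · intro s _ hs
    rw [rmul_bigF, if_neg hs, mul_zero]
  · simp

/-! ### Branching -/

section Branching

variable {n f : ℕ}

/-- The extension of a tableau by a step that keeps the first entry of the partition. -/
def extendSame (t : Tableau n f) : Tableau (n + 1) f :=
  ofEntry (fun k => if k ≤ n then t.entry k else f) (by simp)
    (by
      intro k hk
      have h1 := t.two_mul_entry_le k
      have h2 := t.two_mul_entry_le n
      rw [entry_last] at h2
      split_ifs <;> omega)
    (by
      intro k hk
      rcases (show k < n ∨ k = n by omega) with h | rfl
      · simpa [h, h.le, show k + 1 ≤ n by omega] using Tableau.entry_succ t h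
      · simp)
    (by simp)

/-- The extension of a tableau by a step that raises the first entry of the partition. -/
def extendAdd (hf : 2 * (f + 1) ≤ n + 1) (t : Tableau n f) : Tableau (n + 1) (f + 1) :=
  ofEntry (fun k => if k ≤ n then t.entry k else f + 1) (by simp)
    (by
      intro k hk
      have h1 := t.two_mul_entry_le k
      split_ifs <;> omega)
    (by
      intro k hk
      rcases (show k < n ∨ k = n by omega) with h | rfl
      · simpa [h, h.le, show k + 1 ≤ n by omega] using Tableau.entry_succ t h
      · simp)
    (by simp)

theorem entry_extendSame (t : Tableau n f) {k : ℕ} (hk : k ≤ n) :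
    (extendSame t).entry k = t.entry k := by
  rw [extendSame, entry_ofEntry (by omega), if_pos hk]

theorem entry_extendAdd (hf : 2 * (f + 1) ≤ n + 1) (t : Tableau n f) {k : ℕ} (hk : k ≤ n) :
    (extendAdd hf t).entry k = t.entry k := by
  rw [extendAdd, entry_ofEntry (by omega), if_pos hk]

/-- A path is classified by its last step; this one bijection yields the recursions for both `dim`
and the product of the norms. -/
theorem extend_bijective (hf : 2 * (f + 1) ≤ n + 1) :
    Function.Bijective (Sum.elim (extendSame : Tableau n (f + 1) → _) (extendAdd hf)) := by
  constructor
  · rintro (s | s) (t | t) h <;> simp only [Sum.elim_inl, Sum.elim_inr] at h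
    · refine congrArg Sum.inl (ext_entry fun k hk => ?_)
      rw [← entry_extendSame s hk, h, entry_extendSame t hk]
    · have h1 := entry_extendSame s (le_refl n)
      rw [h, entry_extendAdd hf t le_rfl, entry_last, entry_last] at h1
      omega
    · have h1 := entry_extendSame t (le_refl n)
      rw [← h, entry_extendAdd hf s le_rfl, entry_last, entry_last] at h1
      omega
    · refine congrArg Sum.inr (ext_entry fun k hk => ?_)
      rw [← entry_extendAdd hf s hk, h, entry_extendAdd hf t hk]
  · intro t
    have hl := Tableau.entry_succ t (Nat.lt_succ_self n)
    rw [entry_last] at hl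
    rcases hl with hl | hl
    · refine ⟨Sum.inl (ofEntry t.entry t.entry_zero (fun k _ => t.two_mul_entry_le k)
        (fun k hk => Tableau.entry_succ t (by omega)) hl.symm), ext_entry fun k hk => ?_⟩
      rw [Sum.elim_inl]
      rcases (show k ≤ n ∨ k = n + 1 by omega) with h | rfl
      · rw [entry_extendSame _ h, entry_ofEntry h]
      · rw [entry_last, entry_last]
    · refine ⟨Sum.inr (ofEntry t.entry t.entry_zero (fun k _ => t.two_mul_entry_le k)
        (fun k hk => Tableau.entry_succ t (by omega)) (by omega)), ext_entry fun k hk => ?_⟩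
      rw [Sum.elim_inr]
      rcases (show k ≤ n ∨ k = n + 1 by omega) with h | rfl
      · rw [entry_extendAdd hf _ h, entry_ofEntry h]
      · rw [entry_last, entry_last]

theorem dim_succ (hf : 2 * (f + 1) ≤ n + 1) : dim (n + 1) (f + 1) = dim n (f + 1) + dim n f := by
  rw [dim, dim, dim, ← Fintype.card_sum]
  exact (Fintype.card_of_bijective (extend_bijective hf)).symm

theorem dim_zero_right (n : ℕ) : dim n 0 = 1 := by
  rw [dim, Fintype.card_eq_one_iff]
  refine ⟨baseTableau (by omega), fun t => ext_entry fun k hk => ?_⟩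
  have h1 := t.entry_mono hk le_rfl
  rw [entry_last] at h1
  rw [entry_baseTableau _ hk]
  omega

theorem isEmpty_tableau (h : n < 2 * f) : IsEmpty (Tableau n f) := by
  refine ⟨fun t => ?_⟩
  have := t.two_mul_entry_le n
  rw [entry_last] at this
  omega

variable {K : Type*} [Field K] (x : K)

theorem norm_extendSame (t : Tableau n f) : norm x (extendSame t) = norm x t := by
  rw [norm, Finset.prod_range_succ, norm]
  have : stepNorm x (extendSame t) n = 1 := by
    rw [stepNorm, if_pos]
    rw [entry_last, entry_extendSame t le_rfl, entry_last]
  rw [this, mul_one]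
  refine Finset.prod_congr rfl fun k hk => ?_
  rw [Finset.mem_range] at hk
  rw [stepNorm, stepNorm, entry_extendSame t hk.le, entry_extendSame t hk]

theorem norm_extendAdd (hf : 2 * (f + 1) ≤ n + 1) (t : Tableau n f) :
    norm x (extendAdd hf t) = norm x t * (p x (n + 1 - 2 * f) / p x (n - 2 * f)) := by
  rw [norm, Finset.prod_range_succ, norm]
  have : stepNorm x (extendAdd hf t) n = p x (n + 1 - 2 * f) / p x (n - 2 * f) := by
    rw [stepNorm, if_neg]
    · rw [entry_last]
      congr 2 <;> omega
    · rw [entry_last, entry_extendAdd hf t le_rfl, entry_last]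
      omega
  rw [this]
  congr 1
  refine Finset.prod_congr rfl fun k hk => ?_
  rw [Finset.mem_range] at hk
  rw [stepNorm, stepNorm, entry_extendAdd hf t hk.le, entry_extendAdd hf t hk]

theorem prod_norm_succ (hf : 2 * (f + 1) ≤ n + 1) :
    ∏ t : Tableau (n + 1) (f + 1), norm x t =
      (∏ t : Tableau n (f + 1), norm x t) * ((∏ t : Tableau n f, norm x t) *
        (p x (n + 1 - 2 * f) / p x (n - 2 * f)) ^ dim n f) := by
  rw [← (extend_bijective hf).prod_comp, Fintype.prod_sum_type]
  simp only [Sum.elim_inl, Sum.elim_inr, norm_extendSame, norm_extendAdd, Finset.prod_mul_distrib,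
    Finset.prod_const, Finset.card_univ]
  rfl

theorem prod_norm_zero (n : ℕ) : ∏ t : Tableau n 0, norm x t = 1 := by
  refine Finset.prod_eq_one fun t _ => Finset.prod_eq_one fun k hk => ?_
  rw [Finset.mem_range] at hk
  have h1 := t.entry_mono (show k + 1 ≤ n by omega) le_rfl
  have h2 := t.entry_mono (show k ≤ n by omega) le_rfl
  rw [entry_last] at h1 h2
  rw [stepNorm, if_pos (by omega)]

variable {x}

/-- Splitting the exponents by `dim_succ` pairs `A j` with `A (j + 1)`. Exchanging their
denominators gives the bases of `g x n (f + 1) j` and `g x n f j`, and the term `j = f` supplies the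
extra quotient. -/
theorem prod_g_succ (hP : ∀ k, p x (k + 1) ≠ 0) (hf : 2 * (f + 1) ≤ n + 1) :
    ∏ j ∈ Finset.range (f + 1), g x (n + 1) (f + 1) j =
      (∏ j ∈ Finset.range (f + 1), g x n (f + 1) j) * ((∏ j ∈ Finset.range f, g x n f j) *
        (p x (n + 1 - 2 * f) / p x (n - 2 * f)) ^ dim n f) := by
  let A : ℕ → K := fun j => p x (n + 1 - (f + 1) - j + 1) / p x (f + 1 - j)
  have h1 : ∏ j ∈ Finset.range (f + 1), g x (n + 1) (f + 1) j =
      (∏ j ∈ Finset.range (f + 1), A j ^ dim n j) *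
        ∏ j ∈ Finset.range f, A (j + 1) ^ dim n j := by
    rw [Finset.prod_range_succ', Finset.prod_range_succ' (fun j => A j ^ dim n j),
      mul_right_comm, ← Finset.prod_mul_distrib]
    congr 1
    · refine Finset.prod_congr rfl fun j hj => ?_
      rw [Finset.mem_range] at hj
      rw [← pow_add, ← dim_succ (by omega)]
      rfl
    · rw [g, dim_zero_right, dim_zero_right]
  rw [h1, Finset.prod_range_succ, Finset.prod_range_succ]
  have h2 : (∏ j ∈ Finset.range f, A j ^ dim n j) * ∏ j ∈ Finset.range f, A (j + 1) ^ dim n j =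
      (∏ j ∈ Finset.range f, g x n (f + 1) j) * ∏ j ∈ Finset.range f, g x n f j := by
    rw [← Finset.prod_mul_distrib, ← Finset.prod_mul_distrib]
    refine Finset.prod_congr rfl fun j hj => ?_
    rw [Finset.mem_range] at hj
    simp only [A, g]
    rw [← mul_pow, ← mul_pow]
    congr 1
    rw [show n + 1 - (f + 1) - j + 1 = n - f - j + 1 by omega,
      show n + 1 - (f + 1) - (j + 1) + 1 = n - (f + 1) - j + 1 by omega,
      show f + 1 - (j + 1) = f - j by omega]
    ring
  have h3 : A f ^ dim n f =
      g x n (f + 1) f * (p x (n + 1 - 2 * f) / p x (n - 2 * f)) ^ dim n f := by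
    simp only [A, g]
    rw [← mul_pow]
    congr 1
    have := hP (n - 2 * f - 1)
    rw [show n - 2 * f - 1 + 1 = n - 2 * f by omega] at this
    rw [show n + 1 - (f + 1) - f + 1 = n + 1 - 2 * f by omega,
      show n - (f + 1) - f + 1 = n - 2 * f by omega, show f + 1 - f = 1 by omega, p_one]
    field_simp
  rw [h3]
  linear_combination g x n (f + 1) f * (p x (n + 1 - 2 * f) / p x (n - 2 * f)) ^ dim n f * h2

theorem prod_norm_eq_prod_g (hP : ∀ k, p x (k + 1) ≠ 0) (hf : 2 * f ≤ n) :
    ∏ t : Tableau n f, norm x t = ∏ j ∈ Finset.range f, g x n f j := by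
  induction n generalizing f with
  | zero =>
    obtain rfl : f = 0 := by omega
    rw [prod_norm_zero, Finset.range_zero, Finset.prod_empty]
  | succ n ih =>
    match f with
    | 0 => rw [prod_norm_zero, Finset.range_zero, Finset.prod_empty]
    | f + 1 =>
      rw [prod_norm_succ x hf, prod_g_succ hP hf, ih (by omega : 2 * f ≤ n)]
      congr 1
      rcases (show 2 * (f + 1) ≤ n ∨ n = 2 * f + 1 by omega) with h | rfl
      · exact ih h
      -- There are no paths here, while on the other side numerator and denominator of each `g`
      -- coincide.
      · have := isEmpty_tableau (show 2 * f + 1 < 2 * (f + 1) by omega)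
        rw [Finset.prod_of_isEmpty, Finset.prod_eq_one]
        intro j hj
        rw [Finset.mem_range] at hj
        rw [g, show 2 * f + 1 - (f + 1) - j + 1 = f + 1 - j by omega, div_self, one_pow]
        have := hP (f - j)
        rwa [show f - j + 1 = f + 1 - j by omega] at this

end Branching

/-! ### The generic parameter -/

theorem p_two_eq (k : ℕ) : p (2 : ℤ) k = k := by
  induction k using Nat.twoStepInduction with
  | zero => simp
  | one => simp
  | more k h1 h2 =>
    rw [p_add_two, h1, h2]
    push_cast
    ring

/-- Specializing `x` to `2` turns `p k` into `k`. -/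
theorem p_x_ne_zero (k : ℕ) : p x (k + 1) ≠ 0 := by
  rw [x, ← map_p, Ne, FaithfulSMul.algebraMap_eq_zero_iff]
  intro h
  have h1 := congrArg (evalRingHom (2 : ℤ)) h
  rw [map_p, map_zero, coe_evalRingHom, eval_X, p_two_eq] at h1
  omega

end TemperleyLieb

/-! ### The determinant formulas -/

theorem mainTheorem10 (n f : ℕ) (hf : 2 * f ≤ n) :
    algebraMap (Polynomial ℤ) TemperleyLieb.F
        (TemperleyLieb.gramDet (Polynomial.X : Polynomial ℤ) n f) =
      TemperleyLieb.det TemperleyLieb.x n f ∧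
    (2 * f < n →
      TemperleyLieb.det TemperleyLieb.x n f =
        ∏ j ∈ Finset.range f, TemperleyLieb.g TemperleyLieb.x n f j) ∧
    (n = 2 * f → 1 ≤ f →
      TemperleyLieb.det TemperleyLieb.x n f =
        TemperleyLieb.det TemperleyLieb.x (n - 1) (f - 1) *
          TemperleyLieb.x ^ TemperleyLieb.dim n f) := by
  open TemperleyLieb in
  have hP := p_x_ne_zero
  refine ⟨?_, fun _ => ?_, ?_⟩
  · rw [det_eq_prod_norm hP hf]
    exact algebraMap_gramDet hP (FaithfulSMul.algebraMap_injective _ _) hf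
  · rw [det_eq_prod_norm hP hf, prod_norm_eq_prod_g hP hf]
  · rintro rfl h
    obtain ⟨f, rfl⟩ : ∃ j, f = j + 1 := ⟨f - 1, by omega⟩
    -- A path of length `2f + 2` ending at height zero must end with a down-step from height one.
    -- One branch of the recursion is therefore empty, and the other contributes `p 2 / p 1 = x` for
    -- each path.
    have := isEmpty_tableau (show 2 * f + 1 < 2 * (f + 1) by omega)
    rw [show 2 * (f + 1) - 1 = 2 * f + 1 by omega, Nat.add_sub_cancel,
      det_eq_prod_norm hP hf, det_eq_prod_norm hP (by omega),
      show 2 * (f + 1) = 2 * f + 1 + 1 by ring, prod_norm_succ x (by omega), dim_succ (by omega),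
      Finset.prod_of_isEmpty, one_mul, show 2 * f + 1 + 1 - 2 * f = 2 by omega,
      show 2 * f + 1 - 2 * f = 1 by omega, p_two, p_one, div_one,
      show dim (2 * f + 1) (f + 1) = 0 from Fintype.card_eq_zero, zero_add]
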